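/- Let $\mathbb{k}$ be a field, let $S=\mathbb{k}[x_1,\dots,x_n]$ with $n\ge 2$ be standard graded, and let $I=(f_1,\dots,f_n)$ be generated by a homogeneous regular sequence with degrees $d_i=\deg f_i$, $d_1\le d_2\le\dots\le d_n$, so that $S/I$ is an Artinian complete intersection. Put $|\underline d|=d_1+\dots+d_n$. Definitions. Let $a\in\mathbb{Z}$. All free modules below are graded, and $N(c)$ denotes the twist $N(c)_j=N_{c+j}$. A degree $a$ differential module is a graded $S$-module $D$ with an $S$-linear map $d\colon D\to D(a)$ of degree $0$ such that $d^2=0$; isomorphisms of such are degree-preserving $S$-linear isomorphisms that commute with $d$. A degree $a$ free flag is a degree $a$ differential module with a splitting $D=\bigoplus_{i\ge 0}F_i$ into finitely generated graded free submodules such that $d(F_i)\subseteq\bigoplus_{j<i}F_j$; its anchor is the complex $\cdots\to F_2\to F_1\to F_0$ formed by the components $F_{i+1}\to F_i$ of $d$. For a homogeneous complex $\mathbf{F}=(\cdots\to F_2\to F_1\to F_0)$ of finitely generated graded free $S$-modules (with differentials of degree $0$), its degree $a$ fold $\operatorname{Fold}^a(\mathbf{F})$ is the module $\bigoplus_i F_i(ia)$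 with the differential of $\mathbf{F}$. A degree $a$ free flag is anchored on $\mathbf{F}$ if its anchor is isomorphic to $\mathbf{F}$ with each $F_i$ twisted by $ia$. The complex $\mathbf{F}$ is $a$-rigid if every degree $a$ free flag anchored on $\mathbf{F}$ is isomorphic, as a degree $a$ differential module, to $\operatorname{Fold}^a(\mathbf{F})$. A graded $S$-module is $a$-rigid if some (equivalently every) homogeneous free resolution of it by finitely generated modules is $a$-rigid. Then: 1. If $I$ is not generated by linear forms, then $S/I$ is $a$-rigid for every $a\in\mathbb{Z}$ with $$a<d_1+d_2+n-|\underline d|\qquad\text{or}\qquad a>d_{n-1}+d_n .$$ 2. If $I$ is generated by linear forms, then $S/I$ is $a$-rigid for every integer $a\neq 2$. -/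

import Mathlib

universe u

/-- The additive subgroups `P j` (`j : ℤ`) of the `S`-module `M` make `M` a `ℤ`-graded module over
the `ℕ`-graded ring `S = ⨁ i, 𝒜 i`. -/
structure IsModuleGrading {k S : Type u} [Field k] [CommRing S] [Algebra k S]
    (𝒜 : ℕ → Submodule k S) {M : Type u} [AddCommGroup M] [Module S M]
    (P : ℤ → AddSubgroup M) : Prop where
  isInternal : DirectSum.IsInternal P
  smul_mem : ∀ (i : ℕ) (j : ℤ) (s : S) (m : M), s ∈ 𝒜 i → m ∈ P j → s • m ∈ P (i + j)

/-- A homogeneous complex `X 0 ← X 1 ← X 2 ← ⋯` of finitely generated graded free `S`-modules,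
with differentials of internal degree `0`. -/
structure GradedFreeComplex {k S : Type u} [Field k] [CommRing S] [Algebra k S]
    (𝒜 : ℕ → Submodule k S) where
  X : ℕ → Type u
  [addCommGroup : ∀ i, AddCommGroup (X i)]
  [module : ∀ i, Module S (X i)]
  deg : ∀ i, ℤ → AddSubgroup (X i)
  isGrading : ∀ i, IsModuleGrading 𝒜 (deg i)
  exists_basis : ∀ i, ∃ (r : ℕ) (b : Module.Basis (Fin r) S (X i)), ∀ t, ∃ j, b t ∈ deg i j
  d : ∀ i, X (i + 1) →ₗ[S] X i
  d_comp_d : ∀ i, d i ∘ₗ d (i + 1) = 0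
  d_mem : ∀ (i : ℕ) (j : ℤ) (x : X (i + 1)), x ∈ deg (i + 1) j → d i x ∈ deg i j

attribute [instance] GradedFreeComplex.addCommGroup GradedFreeComplex.module

/-- A (graded) differential `S`-module of degree `a`: a graded module with a square-zero
endomorphism which raises the internal degree by `a`. -/
structure DiffModule {k S : Type u} [Field k] [CommRing S] [Algebra k S]
    (𝒜 : ℕ → Submodule k S) (a : ℤ) where
  D : Type u
  [addCommGroup : AddCommGroup D]
  [module : Module S D]
  deg : ℤ → AddSubgroup D
  isGrading : IsModuleGrading 𝒜 deg
  d : D →ₗ[S] D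
  d_comp_d : d ∘ₗ d = 0
  d_mem : ∀ (j : ℤ) (x : D), x ∈ deg j → d x ∈ deg (j + a)

attribute [instance] DiffModule.addCommGroup DiffModule.module

/-- Two differential modules of degree `a` are isomorphic: there is a bijective `S`-linear map
which preserves internal degrees and commutes with the differentials. -/
def DiffModule.Iso {k S : Type u} [Field k] [CommRing S] [Algebra k S]
    {𝒜 : ℕ → Submodule k S} {a : ℤ} (D E : DiffModule 𝒜 a) : Prop :=
  ∃ φ : D.D ≃ₗ[S] E.D, (∀ (j : ℤ) (x : D.D), x ∈ D.deg j ↔ φ x ∈ E.deg j) ∧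
    ∀ x : D.D, φ (D.d x) = E.d (φ x)

/-- A free flag of degree `a`: a differential module of degree `a` with a splitting
`D = ⨁ i, F i` into graded free submodules (each with a finite basis of homogeneous elements)
such that the differential maps `F i` to `⨁ j < i, F j`. -/
structure FreeFlag {k S : Type u} [Field k] [CommRing S] [Algebra k S]
    (𝒜 : ℕ → Submodule k S) (a : ℤ) extends DiffModule 𝒜 a where
  F : ℕ → Submodule S D
  isInternal : DirectSum.IsInternal F
  exists_basis : ∀ i, ∃ (r : ℕ) (b : Module.Basis (Fin r) S (F i)), ∀ t, ∃ j, (b t : D) ∈ deg j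
  d_mem_iSup : ∀ (i : ℕ) (x : D), x ∈ F i → d x ∈ ⨆ j : Fin i, F j

/-- The free flag `G` of degree `a` is anchored on the complex `C`: the complex formed by the maps
`F (i + 1) → F i` which the differential of `G` induces on the successive quotients of the
filtration by the submodules `⨁ j < i, F j` is isomorphic to `C`, with `C.X i` twisted by `i * a`
(an element of degree `j` of `C.X i` has degree `j - i * a` in the twist `C.X i (i * a)`). -/
def FreeFlag.IsAnchoredOn {k S : Type u} [Field k] [CommRing S] [Algebra k S]
    {𝒜 : ℕ → Submodule k S} {a : ℤ} (G : FreeFlag 𝒜 a) (C : GradedFreeComplex 𝒜) : Prop :=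
  ∃ e : ∀ i, C.X i ≃ₗ[S] G.F i,
    (∀ (i : ℕ) (j : ℤ) (x : C.X i), x ∈ C.deg i j ↔ (e i x : G.D) ∈ G.deg (j - i * a)) ∧
    ∀ (i : ℕ) (x : C.X (i + 1)),
      G.d (e (i + 1) x : G.D) - (e i (C.d i x) : G.D) ∈ ⨆ j : Fin i, G.F j

namespace GradedFreeComplex

variable {k S : Type u} [Field k] [CommRing S] [Algebra k S] {𝒜 : ℕ → Submodule k S}

/-- The degree `m` part of `⨁ i, C.X i (i * a)`. -/
def foldDeg (C : GradedFreeComplex 𝒜) (a : ℤ) (m : ℤ) : AddSubgroup (DirectSum ℕ C.X) where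
  carrier := {x | ∀ i : ℕ, x i ∈ C.deg i (m + i * a)}
  zero_mem' := fun i => (C.deg i _).zero_mem
  add_mem' := fun hx hy i => (C.deg i _).add_mem (hx i) (hy i)
  neg_mem' := fun hx i => (C.deg i _).neg_mem (hx i)

/-- The differential of `C`, as an endomorphism of `⨁ i, C.X i`. -/
def foldD (C : GradedFreeComplex 𝒜) : DirectSum ℕ C.X →ₗ[S] DirectSum ℕ C.X :=
  DirectSum.toModule S ℕ (DirectSum ℕ C.X) fun i =>
    match i with
    | 0 => 0
    | i + 1 => DirectSum.lof S ℕ C.X i ∘ₗ C.d i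

theorem foldD_apply (C : GradedFreeComplex 𝒜) (x : DirectSum ℕ C.X) (i : ℕ) :
    C.foldD x i = C.d i (x (i + 1)) := by
  induction x using DirectSum.induction_on with
  | zero => simp
  | add x y hx hy => simp [hx, hy]
  | of j y =>
    change C.foldD (DirectSum.lof S ℕ C.X j y) i = C.d i (DirectSum.lof S ℕ C.X j y (i + 1))
    rw [foldD, DirectSum.toModule_lof]
    cases j with
    | zero =>
      have h : (DirectSum.lof S ℕ C.X 0 y) (i + 1) = 0 :=
        DirectSum.of_eq_of_ne _ _ _ (by omega)
      rw [h]
      simp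
    | succ j =>
      change (DirectSum.lof S ℕ C.X j (C.d j y)) i = _
      by_cases hij : i = j
      · subst hij
        rw [DirectSum.lof_apply, DirectSum.lof_apply]
      · have h1 : (DirectSum.lof S ℕ C.X (j + 1) y) (i + 1) = 0 :=
          DirectSum.of_eq_of_ne _ _ _ (by omega)
        have h2 : (DirectSum.lof S ℕ C.X j (C.d j y)) i = 0 :=
          DirectSum.of_eq_of_ne _ _ _ (by omega)
        rw [h1, h2, map_zero]

theorem foldDeg_isGrading (C : GradedFreeComplex 𝒜) (a : ℤ) :
    IsModuleGrading 𝒜 (C.foldDeg a) where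
  isInternal := by
    constructor
    · rw [injective_iff_map_eq_zero]
      intro z hz
      -- the family of the `i`-th coordinates, re-indexed by the degree in `C.X i`
      let c : ∀ (i : ℕ) (m : ℤ), C.foldDeg a m →+ C.deg i (m + i * a) := fun i m =>
        { toFun := fun x => ⟨x.1 i, x.2 i⟩
          map_zero' := rfl
          map_add' := fun _ _ => rfl }
      let g : ∀ i : ℕ, (DirectSum ℤ fun m => C.foldDeg a m) →+
          DirectSum ℤ fun m => C.deg i m := fun i =>
        DirectSum.toAddMonoid fun m =>
          (DirectSum.of (fun m => C.deg i m) (m + i * a)).comp (c i m)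
      have hg : ∀ (i : ℕ) (w : DirectSum ℤ fun m => C.foldDeg a m),
          DirectSum.coeAddMonoidHom (C.deg i) (g i w) =
            (DirectSum.coeAddMonoidHom (C.foldDeg a) w) i := by
        intro i w
        induction w using DirectSum.induction_on with
        | zero => simp
        | add x y hx hy => simp [hx, hy]
        | of m y =>
          simp only [g, DirectSum.toAddMonoid_of, DirectSum.coeAddMonoidHom_of,
            AddMonoidHom.comp_apply]
          rfl
      have hg' : ∀ (i : ℕ) (m : ℤ) (w : DirectSum ℤ fun m => C.foldDeg a m),
          ((g i w) (m + i * a) : C.X i) = (w m : DirectSum ℕ C.X) i := by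
        intro i m w
        induction w using DirectSum.induction_on with
        | zero => simp
        | add x y hx hy => simp [hx, hy]
        | of m' y =>
          simp only [g, DirectSum.toAddMonoid_of, AddMonoidHom.comp_apply]
          by_cases hm : m = m'
          · subst hm
            rw [DirectSum.of_eq_same, DirectSum.of_eq_same]
            rfl
          · rw [DirectSum.of_eq_of_ne _ _ _ hm,
              DirectSum.of_eq_of_ne _ _ _ (by simpa using hm)]
            rfl
      ext m i
      have h0 : g i z = 0 := by
        apply (C.isGrading i).isInternal.1
        rw [hg, hz, map_zero]
        rfl
      rw [← hg', h0]
      rfl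
    · intro x
      rw [← AddMonoidHom.mem_range]
      induction x using DirectSum.induction_on with
      | zero => exact zero_mem _
      | add x y hx hy => exact add_mem hx hy
      | of i y =>
        obtain ⟨w, rfl⟩ := (C.isGrading i).isInternal.2 y
        induction w using DirectSum.induction_on with
        | zero => simp
        | add x y hx hy => rw [map_add, map_add]; exact add_mem hx hy
        | of m y =>
          rw [DirectSum.coeAddMonoidHom_of]
          have hmem : DirectSum.of C.X i (y : C.X i) ∈ C.foldDeg a (m - i * a) := by
            intro j
            by_cases hj : j = i
            · subst hj
              rw [DirectSum.of_eq_same, sub_add_cancel]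
              exact y.2
            · rw [DirectSum.of_eq_of_ne _ _ _ hj]
              exact zero_mem _
          exact ⟨DirectSum.of (fun m => C.foldDeg a m) _ ⟨_, hmem⟩,
            DirectSum.coeAddMonoidHom_of _ _ _⟩
  smul_mem := by
    intro i j s m hs hm l
    rw [DirectSum.smul_apply, add_assoc]
    exact (C.isGrading l).smul_mem i _ s _ hs (hm l)

/-- The degree `a` fold of `C`: the module `⨁ i, C.X i (i * a)` with the differential of `C`. -/
def fold (C : GradedFreeComplex 𝒜) (a : ℤ) : DiffModule 𝒜 a where
  D := DirectSum ℕ C.X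
  deg := C.foldDeg a
  isGrading := C.foldDeg_isGrading a
  d := C.foldD
  d_comp_d := by
    refine LinearMap.ext fun x => DFinsupp.ext fun i => ?_
    change C.foldD (C.foldD x) i = 0
    rw [foldD_apply, foldD_apply]
    exact LinearMap.congr_fun (C.d_comp_d i) _
  d_mem := by
    intro j x hx i
    rw [foldD_apply]
    have h := C.d_mem i _ _ (hx (i + 1))
    have e : j + ((i + 1 : ℕ) : ℤ) * a = j + a + i * a := by push_cast; ring
    rwa [e] at h

/-- `C` is `a`-rigid: every free flag of degree `a` anchored on `C` is isomorphic, as a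
differential module of degree `a`, to the degree `a` fold of `C`. -/
def IsRigid (C : GradedFreeComplex 𝒜) (a : ℤ) : Prop :=
  ∀ G : FreeFlag 𝒜 a, G.IsAnchoredOn C → DiffModule.Iso G.toDiffModule (C.fold a)

/-- `C` is a homogeneous free resolution of the module `M` graded by `P`. -/
def IsResolutionOf (C : GradedFreeComplex 𝒜) (M : Type u) [AddCommGroup M] [Module S M]
    (P : ℤ → AddSubgroup M) : Prop :=
  ∃ ε : C.X 0 →ₗ[S] M, (∀ (j : ℤ) (x : C.X 0), x ∈ C.deg 0 j → ε x ∈ P j) ∧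
    Function.Surjective ε ∧ Function.Exact (C.d 0) ε ∧
    ∀ i, Function.Exact (C.d (i + 1)) (C.d i)

end GradedFreeComplex

/-- The module `M` graded by `P` is `a`-rigid: it has homogeneous free resolutions, and all of
them are `a`-rigid (so that both "some resolution" and "every resolution" are asserted). -/
def IsRigidModule {k S : Type u} [Field k] [CommRing S] [Algebra k S] (𝒜 : ℕ → Submodule k S)
    (M : Type u) [AddCommGroup M] [Module S M] (P : ℤ → AddSubgroup M) (a : ℤ) : Prop :=
  (∃ C : GradedFreeComplex 𝒜, C.IsResolutionOf M P) ∧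
    ∀ C : GradedFreeComplex 𝒜, C.IsResolutionOf M P → C.IsRigid a

/-- The grading of `S ⧸ I` induced by that of `S`, indexed by `ℤ` (zero in negative degrees). -/
def quotientGrading {k S : Type u} [Field k] [CommRing S] [Algebra k S] (𝒜 : ℕ → Submodule k S)
    (I : Ideal S) (j : ℤ) : AddSubgroup (S ⧸ I) :=
  if 0 ≤ j then (𝒜 j.toNat).toAddSubgroup.map (Ideal.Quotient.mk I : S →+ S ⧸ I) else ⊥

/-- The ideal `I` of a polynomial ring is generated by linear forms. -/
def IsGeneratedByLinearForms {k : Type u} [Field k] {n : ℕ} (I : Ideal (MvPolynomial (Fin n) k)) :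
    Prop :=
  ∃ T : Set (MvPolynomial (Fin n) k), (∀ g ∈ T, g.IsHomogeneous 1) ∧ Ideal.span T = I

/-! The proof is obstruction theory for the augmentation `F 0 → M`, where `M = S/I`. Regard `M` as a
differential module with zero differential. Extend the augmentation to a map `π` from the whole flag
with `π ∘ d = 0`, one summand at a time. On each new summand the defect of `π ∘ d` is a cocycle of
the resolution with values in `M`, of internal degree `-(p - 1) * a` in cohomological degree `p ≥
2`. If `Ext^p(M, M)` vanishes there, a correction of `π` one step lower removes the defect
(`exists_augmentation`). Exactness of the resolution then lifts `π` through the augmentation of the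
fold to a homogeneous chain map which is the identity modulo lower summands, hence an isomorphism
(`exists_isomorphism`).

The Ext condition does not depend on the resolution (`IsResolutionOf.extVanishes`), so it can be
checked on the iterated mapping cone of the regular sequence, where even the cochains vanish. Its
generators in homological degree `p` have as degrees the sums of `p` distinct `d i`. The Hilbert
series of `S/I` is `∏ (1 - X ^ d i) / (1 - X) ^ n`, a polynomial of degree `∑ d i - n`, so `S/I` is
zero outside the degrees from `0` to `∑ d i - n`.

It remains to see that, for every set `T` of `p + 2` indices, `∑_T d - (p + 1) * a` is negative or
exceeds `∑ d i - n`. A large `a` makes it negative, because `∑_T d` is at most `p + 1` times the sum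
of the two largest degrees. A small `a` makes it too large, because `∑_T d` is at least the sum of
the two smallest. In the linear case all `d i` are `1`, the quotient lives in degree `0`, and `p + 2
= (p + 1) * a` only for `p = 0`, `a = 2`. -/

section Grading

/-! ### Graded modules: projections and homogeneous lifts. -/

variable {k S : Type u} [Field k] [CommRing S] [Algebra k S] {𝒜 : ℕ → Submodule k S}
  {M N : Type u} [AddCommGroup M] [Module S M] [AddCommGroup N] [Module S N]
  {P : ℤ → AddSubgroup M} {Q : ℤ → AddSubgroup N}

/-- A family of subgroups which spans and which admits projections is an internal direct sum. -/
theorem isInternal_of_proj (π : ℤ → M →+ M)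
    (hsame : ∀ m x, x ∈ P m → π m x = x) (hne : ∀ m m' x, x ∈ P m → m ≠ m' → π m' x = 0)
    (hspan : ∀ x, x ∈ ⨆ m, P m) : DirectSum.IsInternal P := by
  constructor
  · rw [injective_iff_map_eq_zero]
    intro z hz
    have key : ∀ (m : ℤ) (w : DirectSum ℤ fun m => P m),
        π m (DirectSum.coeAddMonoidHom P w) = (w m : M) := by
      intro m w
      induction w using DirectSum.induction_on with
      | zero => simp
      | add x y hx hy => simp [hx, hy]
      | of m' y =>
        rw [DirectSum.coeAddMonoidHom_of]
        by_cases hm : m = m'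
        · subst hm
          rw [hsame _ _ y.2, DirectSum.of_eq_same]
        · rw [hne _ _ _ y.2 (Ne.symm hm), DirectSum.of_eq_of_ne _ _ _ hm]
          rfl
    ext m
    rw [← key, hz, map_zero]
    rfl
  · intro x
    rw [← AddMonoidHom.mem_range]
    refine (iSup_le fun m y hy => ?_ : (⨆ m, P m) ≤ _) (hspan x)
    exact ⟨DirectSum.of (fun m => P m) m ⟨y, hy⟩, DirectSum.coeAddMonoidHom_of _ _ _⟩

namespace IsModuleGrading

/-- The projection onto the component of degree `m`. -/
noncomputable def proj (h : IsModuleGrading 𝒜 P) (m : ℤ) : M →+ M where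
  toFun x := ((AddEquiv.ofBijective _ h.isInternal).symm x m : P m)
  map_zero' := by simp
  map_add' x y := by simp

theorem proj_mem (h : IsModuleGrading 𝒜 P) (m : ℤ) (x : M) : h.proj m x ∈ P m :=
  ((AddEquiv.ofBijective _ h.isInternal).symm x m).2

theorem symm_apply_of_mem (h : IsModuleGrading 𝒜 P) {m : ℤ} {x : M} (hx : x ∈ P m) :
    (AddEquiv.ofBijective _ h.isInternal).symm x = DirectSum.of (fun m => P m) m ⟨x, hx⟩ := by
  rw [AddEquiv.symm_apply_eq]
  exact (DirectSum.coeAddMonoidHom_of P m ⟨x, hx⟩).symm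

theorem proj_of_mem (h : IsModuleGrading 𝒜 P) {m : ℤ} {x : M} (hx : x ∈ P m) :
    h.proj m x = x := by
  change (((AddEquiv.ofBijective _ h.isInternal).symm x m : P m) : M) = x
  rw [h.symm_apply_of_mem hx, DirectSum.of_eq_same]

theorem proj_of_mem_ne (h : IsModuleGrading 𝒜 P) {m m' : ℤ} {x : M} (hx : x ∈ P m)
    (hm : m ≠ m') : h.proj m' x = 0 := by
  change (((AddEquiv.ofBijective _ h.isInternal).symm x m' : P m') : M) = 0
  rw [h.symm_apply_of_mem hx, DirectSum.of_eq_of_ne _ _ _ (Ne.symm hm)]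
  rfl

theorem mem_iSup (h : IsModuleGrading 𝒜 P) (x : M) : x ∈ ⨆ m, P m := by
  obtain ⟨w, rfl⟩ := h.isInternal.2 x
  induction w using DirectSum.induction_on with
  | zero => rw [map_zero]; exact zero_mem _
  | add x y hx hy => rw [map_add]; exact add_mem hx hy
  | of m y => rw [DirectSum.coeAddMonoidHom_of]; exact AddSubgroup.mem_iSup_of_mem m y.2

theorem induction_on (h : IsModuleGrading 𝒜 P) {p : M → Prop} (x : M)
    (mem : ∀ m x, x ∈ P m → p x) (add : ∀ x y, p x → p y → p (x + y)) : p x :=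
  AddSubgroup.iSup_induction P (C := p) (h.mem_iSup x) mem (mem 0 0 (zero_mem _)) add

/-- A homogeneous map commutes with the projections. -/
theorem map_proj (hP : IsModuleGrading 𝒜 P) (hQ : IsModuleGrading 𝒜 Q) {g : M →ₗ[S] N} {c : ℤ}
    (hg : ∀ j x, x ∈ P j → g x ∈ Q (j + c)) (j : ℤ) (x : M) :
    g (hP.proj j x) = hQ.proj (j + c) (g x) := by
  refine hP.induction_on (p := fun x => g (hP.proj j x) = hQ.proj (j + c) (g x)) x
    (fun m x hx => ?_) fun x y hx hy => by simp [hx, hy]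
  by_cases hm : m = j
  · subst hm
    rw [hP.proj_of_mem hx, hQ.proj_of_mem (hg _ _ hx)]
  · rw [hP.proj_of_mem_ne hx hm, hQ.proj_of_mem_ne (hg _ _ hx) (by omega), map_zero]

/-- A homogeneous element of the range of a homogeneous map has a homogeneous preimage. -/
theorem exists_mem_eq (hP : IsModuleGrading 𝒜 P) (hQ : IsModuleGrading 𝒜 Q) {g : M →ₗ[S] N}
    {c : ℤ} (hg : ∀ j x, x ∈ P j → g x ∈ Q (j + c)) {j : ℤ} {y : N} (hy : y ∈ Q (j + c))
    (hr : y ∈ LinearMap.range g) : ∃ x ∈ P j, g x = y := by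
  obtain ⟨x, rfl⟩ := hr
  exact ⟨hP.proj j x, hP.proj_mem j x, by rw [hP.map_proj hQ hg, hQ.proj_of_mem hy]⟩

/-- An injective homogeneous map reflects degrees. -/
theorem mem_of_map_mem (hP : IsModuleGrading 𝒜 P) (hQ : IsModuleGrading 𝒜 Q) {g : M →ₗ[S] N}
    {c : ℤ} (hg : ∀ j x, x ∈ P j → g x ∈ Q (j + c)) (hi : Function.Injective g) {j : ℤ} {x : M}
    (hx : g x ∈ Q (j + c)) : x ∈ P j := by
  have h : hP.proj j x = x := hi (by rw [hP.map_proj hQ hg, hQ.proj_of_mem hx])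
  exact h ▸ hP.proj_mem j x

/-- A linear map which is homogeneous on a homogeneous basis is homogeneous. -/
theorem map_mem_of_basis [GradedAlgebra 𝒜] (hP : IsModuleGrading 𝒜 P) (hQ : IsModuleGrading 𝒜 Q)
    {ι : Type*} (b : Module.Basis ι S M) (δ : ι → ℤ) (hb : ∀ t, b t ∈ P (δ t)) {g : M →ₗ[S] N}
    {c : ℤ} (hg : ∀ t, g (b t) ∈ Q (δ t + c)) (j : ℤ) (x : M) (hx : x ∈ P j) :
    g x ∈ Q (j + c) := by
  -- Commuting with the projections is additive in `x`, so it can be tested on homogeneous multiples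
  -- of basis elements.
  have key : ∀ x : M, g (hP.proj j x) = hQ.proj (j + c) (g x) := by
    intro x
    have hx : x ∈ Submodule.span S (Set.range b) := by rw [b.span_eq]; trivial
    induction hx using Submodule.closure_induction with
    | zero => simp
    | add x y _ _ hx hy => simp [hx, hy]
    | smul_mem s x hx =>
      obtain ⟨t, rfl⟩ := hx
      induction s using DirectSum.Decomposition.inductionOn 𝒜 with
      | zero => simp
      | add s s' h h' => simp [add_smul, h, h']
      | homogeneous s =>
        rename_i i
        have h1 := hP.smul_mem _ _ _ _ s.2 (hb t)
        have h2 : g ((s : S) • b t) ∈ Q (i + δ t + c) := by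
          rw [map_smul, add_assoc]
          exact hQ.smul_mem _ _ _ _ s.2 (hg t)
        by_cases h : i + δ t = j
        · subst h
          rw [hP.proj_of_mem h1, hQ.proj_of_mem h2]
        · rw [hP.proj_of_mem_ne h1 h, hQ.proj_of_mem_ne h2 (by omega), map_zero]
  rw [← hP.proj_of_mem hx, key]
  exact hQ.proj_mem _ _

/-- A homogeneous map out of a graded free module can be lifted degree by degree. -/
theorem exists_lift [GradedAlgebra 𝒜] {L : Type u} [AddCommGroup L] [Module S L]
    (hP : IsModuleGrading 𝒜 P) (hQ : IsModuleGrading 𝒜 Q)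
    (hfree : ∃ (r : ℕ) (b : Module.Basis (Fin r) S M), ∀ t, ∃ j, b t ∈ P j)
    (W : Submodule S N) (g : N →ₗ[S] L) (h : M →ₗ[S] L) (c : ℤ)
    (hl : ∀ j x, x ∈ P j → ∃ y ∈ W, y ∈ Q (j + c) ∧ g y = h x) :
    ∃ l : M →ₗ[S] N, (∀ x, l x ∈ W) ∧ (∀ j x, x ∈ P j → l x ∈ Q (j + c)) ∧
      ∀ x, g (l x) = h x := by
  obtain ⟨r, b, hb⟩ := hfree
  choose δ hδ using hb
  choose y hyW hyQ hyg using fun t => hl _ _ (hδ t)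
  have hb : ∀ t, b.constr S y (b t) = y t := b.constr_basis S y
  refine ⟨b.constr S y, fun x => ?_, hP.map_mem_of_basis hQ b δ hδ fun t => ?_, fun x => ?_⟩
  · rw [← b.sum_repr x, map_sum]
    exact sum_mem fun t _ => by rw [map_smul, hb]; exact W.smul_mem _ (hyW t)
  · rw [hb]
    exact hyQ t
  · refine LinearMap.congr_fun (b.ext (f₁ := g ∘ₗ b.constr S y) fun t => ?_) x
    rw [LinearMap.comp_apply, hb, hyg]

theorem prod (hP : IsModuleGrading 𝒜 P) (hQ : IsModuleGrading 𝒜 Q) :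
    IsModuleGrading 𝒜 fun m => (P m).prod (Q m) where
  isInternal := by
    refine isInternal_of_proj (fun m => (hP.proj m).prodMap (hQ.proj m)) ?_ ?_ ?_
    · rintro m ⟨x, y⟩ ⟨hx, hy⟩
      exact Prod.ext (hP.proj_of_mem hx) (hQ.proj_of_mem hy)
    · rintro m m' ⟨x, y⟩ ⟨hx, hy⟩ hm
      exact Prod.ext (hP.proj_of_mem_ne hx hm) (hQ.proj_of_mem_ne hy hm)
    · rintro ⟨x, y⟩
      have hx : ((x, 0) : M × N) ∈ ⨆ m, (P m).prod (Q m) :=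
        hP.induction_on (p := fun x => ((x, 0) : M × N) ∈ ⨆ m, (P m).prod (Q m)) x
          (fun m x hx => AddSubgroup.mem_iSup_of_mem m ⟨hx, zero_mem _⟩)
          fun x y hx hy => by simpa using add_mem hx hy
      have hy : ((0, y) : M × N) ∈ ⨆ m, (P m).prod (Q m) :=
        hQ.induction_on (p := fun y => ((0, y) : M × N) ∈ ⨆ m, (P m).prod (Q m)) y
          (fun m x hx => AddSubgroup.mem_iSup_of_mem m ⟨zero_mem _, hx⟩)
          fun x y hx hy => by simpa using add_mem hx hy
      simpa using add_mem hx hy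
  smul_mem i j s m hs hm := ⟨hP.smul_mem i j s _ hs hm.1, hQ.smul_mem i j s _ hs hm.2⟩

theorem shift (hP : IsModuleGrading 𝒜 P) (c : ℤ) : IsModuleGrading 𝒜 fun m => P (m - c) where
  isInternal := by
    refine isInternal_of_proj (fun m => hP.proj (m - c)) (fun m x hx => hP.proj_of_mem hx)
      (fun m m' x hx hm => hP.proj_of_mem_ne hx (by omega)) fun x => ?_
    refine hP.induction_on (p := fun x => x ∈ ⨆ m, P (m - c)) x (fun m x hx => ?_)
      fun x y hx hy => add_mem hx hy
    exact AddSubgroup.mem_iSup_of_mem (m + c) (by rwa [add_sub_cancel_right])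
  smul_mem i j s m hs hm := by
    rw [add_sub_assoc]
    exact hP.smul_mem i _ s m hs hm

theorem of_subsingleton [Subsingleton M] : IsModuleGrading 𝒜 P where
  isInternal := isInternal_of_proj (fun _ => 0) (fun _ _ _ => Subsingleton.elim _ _)
    (fun _ _ _ _ _ => rfl) fun x => by rw [Subsingleton.elim x 0]; exact zero_mem _
  smul_mem i j s m _ _ := by rw [Subsingleton.elim (s • m) 0]; exact zero_mem _

end IsModuleGrading

/-- A sequence built by dependent choice. -/
theorem exists_dependent_seq {T : ℕ → Type*} (Q : ∀ i, T i → Prop)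
    (R : ∀ i, T i → T (i + 1) → Prop) (h0 : ∃ x, Q 0 x)
    (hs : ∀ i x, Q i x → ∃ y, Q (i + 1) y ∧ R i x y) :
    ∃ s : ∀ i, T i, (∀ i, Q i (s i)) ∧ ∀ i, R i (s i) (s (i + 1)) := by
  obtain ⟨x0, hx0⟩ := h0
  choose g hg hg' using hs
  let s : ∀ i, { x : T i // Q i x } := fun i =>
    Nat.rec ⟨x0, hx0⟩ (fun i x => ⟨g i x.1 x.2, hg i x.1 x.2⟩) i
  exact ⟨fun i => (s i).1, fun i => (s i).2, fun i => hg' i _ (s i).2⟩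

end Grading

/-! ### Filtered direct sums and the extension of the augmentation to a flag. -/

namespace GradedFreeComplex

variable {k S : Type u} [Field k] [CommRing S] [Algebra k S] {𝒜 : ℕ → Submodule k S}

/-- The submodule `⨁ j < i, C.X j` of `⨁ j, C.X j`. -/
def lowerPart (C : GradedFreeComplex 𝒜) (i : ℕ) : Submodule S (DirectSum ℕ C.X) where
  carrier := {x | ∀ j, i ≤ j → x j = 0}
  zero_mem' := fun _ _ => rfl
  add_mem' := fun {x y} hx hy j hj => by rw [DirectSum.add_apply, hx j hj, hy j hj, add_zero]
  smul_mem' := fun s x hx j hj => by rw [DirectSum.smul_apply, hx j hj, smul_zero]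

variable (C : GradedFreeComplex 𝒜)

/-- The inclusion of the `i`-th summand. -/
abbrev incl (i : ℕ) : C.X i →ₗ[S] DirectSum ℕ C.X := DirectSum.lof S ℕ C.X i

/-- The projection to the `i`-th summand. -/
abbrev coord (i : ℕ) : DirectSum ℕ C.X →ₗ[S] C.X i := DirectSum.component S ℕ C.X i

theorem incl_same (i : ℕ) (x : C.X i) : C.incl i x i = x := DirectSum.of_eq_same _ _

theorem incl_ne {i j : ℕ} (h : j ≠ i) (x : C.X i) : C.incl i x j = 0 :=
  DirectSum.of_eq_of_ne _ _ _ h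

theorem lowerPart_mono {i j : ℕ} (h : i ≤ j) : C.lowerPart i ≤ C.lowerPart j :=
  fun _ hx l hl => hx l (h.trans hl)

theorem incl_mem_lowerPart {i j : ℕ} (h : j < i) (x : C.X j) : C.incl j x ∈ C.lowerPart i :=
  fun _ hl => C.incl_ne (by omega) x

theorem incl_mem_foldDeg {a m : ℤ} {i : ℕ} {x : C.X i} :
    C.incl i x ∈ C.foldDeg a m ↔ x ∈ C.deg i (m + i * a) := by
  refine ⟨fun h => by simpa only [C.incl_same] using h i, fun h j => ?_⟩
  by_cases hj : j = i
  · subst hj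
    rwa [C.incl_same]
  · rw [C.incl_ne hj]
    exact zero_mem _

theorem mem_of_incl_mem (W : AddSubgroup (DirectSum ℕ C.X)) {x : DirectSum ℕ C.X}
    (h : ∀ j, C.incl j (x j) ∈ W) : x ∈ W := by
  classical
  rw [← DirectSum.sum_support_of x]
  exact sum_mem fun j _ => h j

theorem lowerPart_le {i : ℕ} (W : Submodule S (DirectSum ℕ C.X))
    (h : ∀ j, j < i → ∀ y, C.incl j y ∈ W) : C.lowerPart i ≤ W := by
  intro x hx
  refine C.mem_of_incl_mem W.toAddSubgroup fun j => ?_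
  by_cases hj : j < i
  · exact h j hj _
  · rw [hx j (by omega), map_zero]
    exact zero_mem _

theorem exists_mem_lowerPart (x : DirectSum ℕ C.X) : ∃ i, x ∈ C.lowerPart i := by
  induction x using DirectSum.induction_on with
  | zero => exact ⟨0, zero_mem _⟩
  | of j y => exact ⟨j + 1, C.incl_mem_lowerPart (Nat.lt_succ_self j) y⟩
  | add x y hx hy =>
    obtain ⟨i, hi⟩ := hx
    obtain ⟨j, hj⟩ := hy
    exact ⟨max i j, add_mem (C.lowerPart_mono (le_max_left _ _) hi)
      (C.lowerPart_mono (le_max_right _ _) hj)⟩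

theorem foldD_incl_zero (x : C.X 0) : C.foldD (C.incl 0 x) = 0 := by
  refine DFinsupp.ext fun i => ?_
  rw [foldD_apply, C.incl_ne (by omega), map_zero]
  rfl

theorem foldD_incl_succ (i : ℕ) (x : C.X (i + 1)) :
    C.foldD (C.incl (i + 1) x) = C.incl i (C.d i x) := by
  rw [foldD, DirectSum.toModule_lof]
  rfl

/-- Extension of linear maps from the truncations to the whole direct sum. -/
theorem exists_limit {N : Type u} [AddCommGroup N] [Module S N]
    (Q : ℕ → (DirectSum ℕ C.X →ₗ[S] N) → Prop) (h0 : ∃ Ψ, Q 0 Ψ)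
    (hs : ∀ i Ψ, Q i Ψ → ∃ κ : C.X (i + 1) →ₗ[S] N, Q (i + 1) (Ψ + κ ∘ₗ C.coord (i + 1))) :
    ∃ Ψ : DirectSum ℕ C.X →ₗ[S] N, ∀ i, ∃ Ψ', Q i Ψ' ∧
      ∀ x ∈ C.lowerPart (i + 1), Ψ x = Ψ' x := by
  obtain ⟨s, hsQ, hsR⟩ := exists_dependent_seq (T := fun _ => DirectSum ℕ C.X →ₗ[S] N) Q
    (fun i Ψ Ψ' => ∃ κ : C.X (i + 1) →ₗ[S] N, Ψ' = Ψ + κ ∘ₗ C.coord (i + 1)) h0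
    (fun i Ψ h => by
      obtain ⟨κ, hκ⟩ := hs i Ψ h
      exact ⟨_, hκ, κ, rfl⟩)
  have hstep : ∀ i j, j ≤ i → ∀ y : C.X j, s i (C.incl j y) = s j (C.incl j y) := by
    intro i j hj y
    induction i, hj using Nat.le_induction with
    | base => rfl
    | succ i hi ih =>
      obtain ⟨κ, hκ⟩ := hsR i
      rw [← ih, hκ, LinearMap.add_apply, LinearMap.comp_apply]
      have : C.coord (i + 1) (C.incl j y) = 0 := C.incl_ne (by omega) y
      rw [this, map_zero, add_zero]
  refine ⟨DirectSum.toModule S ℕ N fun i => s i ∘ₗ C.incl i, fun i => ⟨s i, hsQ i, fun x hx => ?_⟩⟩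
  refine C.lowerPart_le (LinearMap.eqLocus (DirectSum.toModule S ℕ N fun i => s i ∘ₗ C.incl i)
    (s i)) (fun j hj y => ?_) hx
  rw [LinearMap.mem_eqLocus, DirectSum.toModule_lof, LinearMap.comp_apply, hstep i j (by omega)]

/-- A differential of degree `a` on `⨁ i, C.X i (i * a)` which makes it a free flag whose anchor
is `C`. -/
structure IsAnchoredDifferential (a : ℤ) (D : DirectSum ℕ C.X →ₗ[S] DirectSum ℕ C.X) : Prop where
  sq_zero : ∀ x, D (D x) = 0
  mem : ∀ j x, x ∈ C.foldDeg a j → D x ∈ C.foldDeg a (j + a)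
  incl_zero : ∀ x, D (C.incl 0 x) = 0
  incl_succ : ∀ i x, D (C.incl (i + 1) x) - C.incl i (C.d i x) ∈ C.lowerPart i

/-- Cocycles `C.X p ⟶ M` of internal degree `-(p - 1) * a` with `p ≥ 2` are coboundaries. -/
def ExtVanishes (a : ℤ) (M : Type u) [AddCommGroup M] [Module S M] (P : ℤ → AddSubgroup M) : Prop :=
  ∀ (p : ℕ) (θ : C.X (p + 2) →ₗ[S] M),
    (∀ j x, x ∈ C.deg (p + 2) j → θ x ∈ P (j + -((p + 1 : ℕ) * a))) →
    (∀ x, θ (C.d (p + 2) x) = 0) →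
    ∃ κ : C.X (p + 1) →ₗ[S] M,
      (∀ j x, x ∈ C.deg (p + 1) j → κ x ∈ P (j + -((p + 1 : ℕ) * a))) ∧
      ∀ x, κ (C.d (p + 1) x) = θ x

namespace IsAnchoredDifferential

variable {C} {a : ℤ} {D : DirectSum ℕ C.X →ₗ[S] DirectSum ℕ C.X}
  (hD : C.IsAnchoredDifferential a D)
include hD

theorem incl_mem (i : ℕ) (x : C.X i) : D (C.incl i x) ∈ C.lowerPart i := by
  cases i with
  | zero => rw [hD.incl_zero]; exact zero_mem _
  | succ i =>
    rw [← sub_add_cancel (D _) (C.incl i (C.d i x))]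
    exact add_mem (C.lowerPart_mono (by omega) (hD.incl_succ i x))
      (C.incl_mem_lowerPart (by omega) _)

theorem map_lowerPart {i : ℕ} {x : DirectSum ℕ C.X} (hx : x ∈ C.lowerPart (i + 1)) :
    D x ∈ C.lowerPart i :=
  C.lowerPart_le ((C.lowerPart i).comap D)
    (fun j hj y => C.lowerPart_mono (by omega) (hD.incl_mem j y)) hx

variable {M : Type u} [AddCommGroup M] [Module S M] {P : ℤ → AddSubgroup M} {ε : C.X 0 →ₗ[S] M}

/-- The augmentation extends to a morphism from the free flag to `M` with zero differential. -/
theorem exists_augmentation (hε : ∀ j x, x ∈ C.deg 0 j → ε x ∈ P j) (hεd : ∀ x, ε (C.d 0 x) = 0)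
    (hext : C.ExtVanishes a M P) :
    ∃ π : DirectSum ℕ C.X →ₗ[S] M, (∀ j x, x ∈ C.foldDeg a j → π x ∈ P j) ∧
      (∀ x, π (C.incl 0 x) = ε x) ∧ ∀ x, π (D x) = 0 := by
  -- At stage `i` the map is final on `C.X j` for `j ≤ i`, and `ρ ∘ D` already vanishes one summand
  -- further, on `C.X j` for `j ≤ i + 1`, since `D` lowers the filtration. The base case is `ε ∘ d =
  -- 0`.
  obtain ⟨π, hπ⟩ := C.exists_limit (fun i ρ => (∀ j x, x ∈ C.foldDeg a j → ρ x ∈ P j) ∧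
      (∀ x, ρ (C.incl 0 x) = ε x) ∧ ∀ x ∈ C.lowerPart (i + 2), ρ (D x) = 0)
    ⟨ε ∘ₗ C.coord 0, fun j x hx => hε j _ (by
        have h := hx 0
        rwa [Nat.cast_zero, zero_mul, add_zero] at h),
      fun x => congrArg ε (C.incl_same 0 x), fun x hx => by
        refine C.lowerPart_le (LinearMap.ker (ε ∘ₗ C.coord 0 ∘ₗ D)) (fun j hj y => ?_) hx
        rw [LinearMap.mem_ker, LinearMap.comp_apply, LinearMap.comp_apply]
        interval_cases j
        · rw [hD.incl_zero, map_zero, map_zero]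
        · have := hD.incl_succ 0 y 0 le_rfl
          rw [DirectSum.sub_apply, sub_eq_zero] at this
          change ε (D (C.incl 1 y) 0) = 0
          rw [this, C.incl_same, hεd]⟩ (by
      rintro i ρ ⟨hdeg, h0, hρD⟩
      -- The defect of `ρ ∘ D` on `C.X (i + 2)` is a cocycle: up to terms killed by `ρ ∘ D`, `C.d`
      -- may be replaced by `D`, and `D ∘ D = 0`. The correction `κ` lives on `C.X (i + 1)`, so it
      -- does not disturb `ρ ∘ D` on earlier summands.
      obtain ⟨κ, hκ, hκd⟩ := hext i (-(ρ ∘ₗ D ∘ₗ C.incl (i + 2)))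
        (fun j x hx => by
          have h1 : C.incl (i + 2) x ∈ C.foldDeg a (j - (i + 2 : ℕ) * a) :=
            C.incl_mem_foldDeg.2 (by rwa [sub_add_cancel])
          have h2 := neg_mem (hdeg _ _ (hD.mem _ _ h1))
          rw [show j - (i + 2 : ℕ) * a + a = j + -((i + 1 : ℕ) * a) by push_cast; ring] at h2
          exact h2)
        (fun x => by
          have h1 := hρD _ (C.lowerPart_mono le_rfl (hD.incl_succ (i + 2) x))
          rw [map_sub, hD.sq_zero, zero_sub, map_neg] at h1
          simpa using h1)
      refine ⟨κ, fun j x hx => ?_, fun x => ?_, fun x hx => ?_⟩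
      · refine add_mem (hdeg j x hx) ?_
        have := hκ _ _ (hx (i + 1))
        rwa [add_neg_cancel_right] at this
      · rw [LinearMap.add_apply, h0, LinearMap.comp_apply]
        have : C.coord (i + 1) (C.incl 0 x) = 0 := C.incl_ne (Nat.succ_ne_zero i) x
        rw [this, map_zero, add_zero]
      · refine C.lowerPart_le (LinearMap.ker ((ρ + κ ∘ₗ C.coord (i + 1)) ∘ₗ D)) (fun j hj y => ?_) hx
        rw [LinearMap.mem_ker, LinearMap.comp_apply, LinearMap.add_apply, LinearMap.comp_apply]
        rcases Nat.lt_succ_iff_lt_or_eq.1 hj with hj | rfl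
        · rw [hρD _ (C.incl_mem_lowerPart hj y)]
          have : C.coord (i + 1) (D (C.incl j y)) = 0 := hD.incl_mem j y (i + 1) (by omega)
          rw [this, map_zero, add_zero]
        · have h1 := hD.incl_succ (i + 1) y (i + 1) le_rfl
          rw [DirectSum.sub_apply, sub_eq_zero, C.incl_same] at h1
          have : C.coord (i + 1) (D (C.incl (i + 1 + 1) y)) = C.d (i + 1) y := h1
          rw [this, hκd]
          simp)
  refine ⟨π, fun j x hx => ?_, fun x => ?_, fun x => ?_⟩
  · obtain ⟨i, hi⟩ := C.exists_mem_lowerPart x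
    obtain ⟨ρ, hρ, hρπ⟩ := hπ i
    rw [hρπ x (C.lowerPart_mono (by omega) hi)]
    exact hρ.1 j x hx
  · obtain ⟨ρ, hρ, hρπ⟩ := hπ 0
    rw [hρπ _ (C.incl_mem_lowerPart (by omega) _), hρ.2.1]
  · obtain ⟨i, hi⟩ := C.exists_mem_lowerPart x
    obtain ⟨ρ, hρ, hρπ⟩ := hπ i
    rw [hρπ _ (C.lowerPart_mono (Nat.le_succ i)
      (hD.map_lowerPart (C.lowerPart_mono (by omega) hi))),
      hρ.2.2 x (C.lowerPart_mono (by omega) hi)]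

end IsAnchoredDifferential

end GradedFreeComplex

/-! ### Lifting the augmentation to an isomorphism with the fold. -/

namespace GradedFreeComplex

variable {k S : Type u} [Field k] [CommRing S] [Algebra k S] {𝒜 : ℕ → Submodule k S}
  (C : GradedFreeComplex 𝒜)

/-- An endomorphism which is unipotent for the filtration by the `C.lowerPart i` is bijective. -/
theorem bijective_of_unipotent (φ : DirectSum ℕ C.X →ₗ[S] DirectSum ℕ C.X)
    (h : ∀ i x, φ (C.incl i x) - C.incl i x ∈ C.lowerPart i) : Function.Bijective φ := by
  -- `φ - id` lowers the filtration by one step and every element lies in some finite step, so both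
  -- injectivity and surjectivity follow by induction on the step.
  have key : ∀ i, ∀ x ∈ C.lowerPart (i + 1), φ x - x ∈ C.lowerPart i := by
    intro i x hx
    have h1 : C.lowerPart (i + 1) ≤ (C.lowerPart i).comap (φ - LinearMap.id) :=
      C.lowerPart_le _ fun j hj y => C.lowerPart_mono (Nat.lt_succ_iff.1 hj) (h j y)
    exact h1 hx
  constructor
  · rw [injective_iff_map_eq_zero]
    intro x hx
    obtain ⟨i, hi⟩ := C.exists_mem_lowerPart x
    induction i with
    | zero => exact DFinsupp.ext fun j => hi j (Nat.zero_le j)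
    | succ i ih =>
      have h1 := key i x hi
      rw [hx, zero_sub, neg_mem_iff] at h1
      exact ih h1
  · intro y
    rw [← LinearMap.mem_range]
    obtain ⟨i, hi⟩ := C.exists_mem_lowerPart y
    induction i generalizing y with
    | zero =>
      have : y = 0 := DFinsupp.ext fun j => hi j (Nat.zero_le j)
      rw [this]
      exact zero_mem _
    | succ i ih =>
      have h1 := ih _ (key i y hi)
      have h2 := sub_mem (LinearMap.mem_range_self φ y) h1
      rwa [sub_sub_cancel] at h2

theorem foldD_foldD (x : DirectSum ℕ C.X) : C.foldD (C.foldD x) = 0 :=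
  LinearMap.congr_fun (C.fold 0).d_comp_d x

theorem foldD_mem {a j : ℤ} {x : DirectSum ℕ C.X} (hx : x ∈ C.foldDeg a j) :
    C.foldD x ∈ C.foldDeg a (j + a) :=
  (C.fold a).d_mem j x hx

variable {M : Type u} [AddCommGroup M] [Module S M] {P : ℤ → AddSubgroup M} {ε : C.X 0 →ₗ[S] M}

/-- A cycle of the fold of a resolution which augments to zero is a boundary. -/
theorem exists_foldD_eq (hε : Function.Exact (C.d 0) ε)
    (hex : ∀ i, Function.Exact (C.d (i + 1)) (C.d i)) {a m : ℤ} {i : ℕ} {z : DirectSum ℕ C.X}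
    (hzi : z ∈ C.lowerPart i) (hzm : z ∈ C.foldDeg a (m + a)) (hz : C.foldD z = 0)
    (hz0 : ε (z 0) = 0) :
    ∃ y ∈ C.lowerPart (i + 1), y ∈ C.foldDeg a m ∧ C.foldD y = z ∧ y 0 = 0 := by
  have hr : ∀ l, z l ∈ LinearMap.range (C.d l) := by
    intro l
    cases l with
    | zero => exact (hε _).1 hz0
    | succ l => exact (hex l _).1 (by rw [← foldD_apply, hz]; rfl)
  have hw : ∀ l, ∃ w ∈ C.deg (l + 1) (m + (l + 1 : ℕ) * a), C.d l w = z l := by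
    intro l
    have h1 := hzm l
    rw [show m + a + l * a = m + (l + 1 : ℕ) * a + 0 by push_cast; ring] at h1
    exact (C.isGrading (l + 1)).exists_mem_eq (C.isGrading l)
      (fun j x hx => by rw [add_zero]; exact C.d_mem l j x hx) h1 (hr l)
  choose w hwm hwd using hw
  -- The preimages move up one homological degree; coordinate `0` is free and is set to zero so that
  -- the augmentation can be adjusted there independently.
  let v : ∀ l, C.X l := fun l =>
    match l with
    | 0 => 0
    | l + 1 => w l
  let y : DirectSum ℕ C.X := DirectSum.mk C.X (Finset.range (i + 1)) fun l => v l
  have hy : ∀ l, l < i + 1 → y l = v l := fun l hl =>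
    DirectSum.mk_apply_of_mem (Finset.mem_range.2 hl)
  have hy' : ∀ l, ¬ l < i + 1 → y l = 0 := fun l hl =>
    DirectSum.mk_apply_of_notMem (by rwa [Finset.mem_range])
  refine ⟨y, fun l hl => hy' l (by omega), fun l => ?_, DFinsupp.ext fun l => ?_, hy 0 (by omega)⟩
  · by_cases hl : l < i + 1
    · rw [hy l hl]
      cases l with
      | zero => exact zero_mem _
      | succ l => exact hwm l
    · rw [hy' l hl]
      exact zero_mem _
  · rw [foldD_apply]
    by_cases hl : l < i
    · rw [hy _ (by omega)]
      exact hwd l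
    · rw [hy' _ (by omega), map_zero]
      exact (hzi l (by omega)).symm

namespace IsAnchoredDifferential

variable {C} [GradedAlgebra 𝒜] {a : ℤ} {D : DirectSum ℕ C.X →ₗ[S] DirectSum ℕ C.X}
  (hD : C.IsAnchoredDifferential a D)
include hD

/-- The augmentation of a free flag lifts to an isomorphism with the fold. -/
theorem exists_isomorphism (hP : IsModuleGrading 𝒜 P) (hε : ∀ j x, x ∈ C.deg 0 j → ε x ∈ P j)
    (hsurj : Function.Surjective ε) (hεd : Function.Exact (C.d 0) ε)
    (hex : ∀ i, Function.Exact (C.d (i + 1)) (C.d i))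
    {π : DirectSum ℕ C.X →ₗ[S] M} (hπ : ∀ j x, x ∈ C.foldDeg a j → π x ∈ P j)
    (hπ0 : ∀ x, π (C.incl 0 x) = ε x) (hπD : ∀ x, π (D x) = 0) :
    ∃ φ : DirectSum ℕ C.X →ₗ[S] DirectSum ℕ C.X, Function.Bijective φ ∧
      (∀ j x, x ∈ C.foldDeg a j → φ x ∈ C.foldDeg a j) ∧ ∀ x, φ (D x) = C.foldD (φ x) := by
  have hε0 : ∀ x, ε (C.d 0 x) = 0 := fun x => (hεd _).2 ⟨x, rfl⟩
  -- The compatibility `ε (ψ x 0) = π x` is carried along because it makes the zeroth coordinate of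
  -- the next defect a boundary.
  obtain ⟨φ, hφ⟩ := C.exists_limit (fun i ψ => (∀ j x, x ∈ C.foldDeg a j → ψ x ∈ C.foldDeg a j) ∧
      (∀ j x, ψ (C.incl j x) - C.incl j x ∈ C.lowerPart j) ∧
      ∀ x ∈ C.lowerPart (i + 1), ψ (D x) = C.foldD (ψ x) ∧ ε (ψ x 0) = π x)
    ⟨LinearMap.id, fun _ _ h => h, fun j x => by rw [LinearMap.id_apply, sub_self]; exact zero_mem _,
      fun x hx => by
        refine C.lowerPart_le (LinearMap.ker (D - C.foldD) ⊓ LinearMap.ker (ε ∘ₗ C.coord 0 - π))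
          (fun j hj y => ?_) hx |>.imp ?_ ?_
        · obtain rfl : j = 0 := by omega
          constructor
          · rw [SetLike.mem_coe, LinearMap.mem_ker, LinearMap.sub_apply, hD.incl_zero, C.foldD_incl_zero,
              sub_zero]
          · rw [SetLike.mem_coe, LinearMap.mem_ker, LinearMap.sub_apply, hπ0, sub_eq_zero]
            exact congrArg ε (C.incl_same 0 y)
        · exact fun h => sub_eq_zero.1 h
        · exact fun h => sub_eq_zero.1 h⟩ (by
      rintro i ψ ⟨hdeg, huni, hψ⟩
      have hlow : ∀ l, ∀ x ∈ C.lowerPart l, ψ x ∈ C.lowerPart l := fun l x hx =>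
        C.lowerPart_le ((C.lowerPart l).comap ψ) (fun j hj y => by
          have h1 := add_mem (C.lowerPart_mono hj.le (huni j y)) (C.incl_mem_lowerPart hj y)
          rwa [sub_add_cancel] at h1) hx
      -- The value on `C.X (i + 1)` is to become `incl + κ`. The chain map equation and the
      -- augmentation condition on `κ` are solved together as one lifting problem into a product.
      obtain ⟨κ, hκi, hκm, hκ⟩ := (C.isGrading (i + 1)).exists_lift (C.foldDeg_isGrading a)
        (C.exists_basis (i + 1)) (C.lowerPart (i + 1)) (C.foldD.prod (ε ∘ₗ C.coord 0))
        ((ψ ∘ₗ D ∘ₗ C.incl (i + 1) - C.foldD ∘ₗ C.incl (i + 1)).prod (π ∘ₗ C.incl (i + 1)))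
        (-((i + 1 : ℕ) * a)) (fun j x hx => by
          have hx' : C.incl (i + 1) x ∈ C.foldDeg a (j + -((i + 1 : ℕ) * a)) :=
            C.incl_mem_foldDeg.2 (by rwa [neg_add_cancel_right])
          have hDx := hD.incl_mem (i + 1) x
          -- The defect lies in `lowerPart i`: the leading term of `D` is `C.d i`, and the leading
          -- term of `ψ` is the identity. Its augmentation is `π (D _) = 0`, so it bounds.
          obtain ⟨y, hyi, hym, hyd, hy0⟩ := C.exists_foldD_eq (ε := ε) hεd hex (a := a)
            (m := j + -((i + 1 : ℕ) * a)) (i := i)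
            (z := ψ (D (C.incl (i + 1) x)) - C.foldD (C.incl (i + 1) x))
            (by
              have h1 := huni i (C.d i x)
              have h2 := hlow i _ (hD.incl_succ i x)
              have h3 := add_mem h1 h2
              rw [map_sub] at h3
              rw [C.foldD_incl_succ]
              convert h3 using 1
              abel)
            (sub_mem (hdeg _ _ (hD.mem _ _ hx')) (C.foldD_mem hx'))
            (by rw [map_sub, C.foldD_foldD, sub_zero, ← (hψ _ hDx).1, hD.sq_zero, map_zero])
            (by
              rw [DirectSum.sub_apply, map_sub, (hψ _ hDx).2, hπD, foldD_apply, hε0, sub_zero])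
          -- Elements of `C.X 0` are cycles of the fold, so adding `w` corrects the augmentation
          -- without changing the boundary.
          obtain ⟨w, hw, hwε⟩ := (C.isGrading 0).exists_mem_eq hP (c := 0)
            (fun j x hx => by rw [add_zero]; exact hε j x hx)
            (by rw [add_zero]; exact hπ _ _ hx') (hsurj _)
          refine ⟨y + C.incl 0 w, add_mem hyi (C.incl_mem_lowerPart (by omega) w),
            add_mem hym (C.incl_mem_foldDeg.2 (by simpa using hw)), Prod.ext ?_ ?_⟩
          · change C.foldD (y + C.incl 0 w) = _
            rw [map_add, hyd, C.foldD_incl_zero, add_zero]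
            rfl
          · change ε ((y + C.incl 0 w) 0) = _
            rw [DirectSum.add_apply, hy0, C.incl_same, zero_add, hwε]
            rfl)
      have hκ1 : ∀ x, C.foldD (κ x) = ψ (D (C.incl (i + 1) x)) - C.foldD (C.incl (i + 1) x) :=
        fun x => congrArg Prod.fst (hκ x)
      have hκ2 : ∀ x, ε (κ x 0) = π (C.incl (i + 1) x) := fun x => congrArg Prod.snd (hκ x)
      clear hκ
      -- The limit construction adds a map to `ψ`, so the current value of `ψ` on `C.X (i + 1)` has
      -- to be subtracted.
      let χ : C.X (i + 1) →ₗ[S] DirectSum ℕ C.X := C.incl (i + 1) + κ - ψ ∘ₗ C.incl (i + 1)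
      have hχlow : ∀ x ∈ C.lowerPart (i + 1), (ψ + χ ∘ₗ C.coord (i + 1)) x = ψ x := by
        intro x hx
        have : C.coord (i + 1) x = 0 := hx (i + 1) le_rfl
        rw [LinearMap.add_apply, LinearMap.comp_apply, this, map_zero, add_zero]
      have hχtop : ∀ x, (ψ + χ ∘ₗ C.coord (i + 1)) (C.incl (i + 1) x) =
          C.incl (i + 1) x + κ x := by
        intro x
        have : C.coord (i + 1) (C.incl (i + 1) x) = x := C.incl_same _ x
        rw [LinearMap.add_apply, LinearMap.comp_apply, this]
        simp only [χ, LinearMap.add_apply, LinearMap.sub_apply, LinearMap.comp_apply]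
        abel
      refine ⟨χ, fun j x hx => ?_, fun j x => ?_, fun x hx => ?_⟩
      · have h1 := hx (i + 1)
        have h2 : C.incl (i + 1) (x (i + 1)) ∈ C.foldDeg a j := C.incl_mem_foldDeg.2 h1
        have h3 := hκm _ _ h1
        rw [add_neg_cancel_right] at h3
        exact add_mem (hdeg j x hx) (sub_mem (add_mem h2 h3) (hdeg _ _ h2))
      · by_cases hj : j = i + 1
        · subst hj
          rw [hχtop, add_sub_cancel_left]
          exact hκi x
        · have : C.coord (i + 1) (C.incl j x) = 0 := C.incl_ne (Ne.symm hj) x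
          rw [LinearMap.add_apply, LinearMap.comp_apply, this, map_zero, add_zero]
          exact huni j x
      · refine C.lowerPart_le (LinearMap.ker ((ψ + χ ∘ₗ C.coord (i + 1)) ∘ₗ D -
            C.foldD ∘ₗ (ψ + χ ∘ₗ C.coord (i + 1))) ⊓
          LinearMap.ker (ε ∘ₗ C.coord 0 ∘ₗ (ψ + χ ∘ₗ C.coord (i + 1)) - π))
          (fun j hj y => ?_) hx |>.imp ?_ ?_
        · rw [Submodule.mem_inf, LinearMap.mem_ker, LinearMap.mem_ker, LinearMap.sub_apply,
            LinearMap.sub_apply, sub_eq_zero, sub_eq_zero]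
          simp only [LinearMap.comp_apply]
          rw [hχlow _ (C.lowerPart_mono (by omega) (hD.incl_mem j y))]
          rcases Nat.lt_succ_iff_lt_or_eq.1 hj with hj | rfl
          · rw [hχlow _ (C.incl_mem_lowerPart hj y)]
            exact hψ _ (C.incl_mem_lowerPart hj y)
          · rw [hχtop, map_add, hκ1, add_sub_cancel]
            refine ⟨rfl, ?_⟩
            change ε ((C.incl (i + 1) y + κ y) 0) = _
            rw [DirectSum.add_apply, C.incl_ne (Nat.succ_ne_zero i).symm, zero_add, hκ2]
        · exact fun h => sub_eq_zero.1 h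
        · exact fun h => sub_eq_zero.1 h)
  have hlim : ∀ x, ∃ i, x ∈ C.lowerPart (i + 1) := fun x =>
    (C.exists_mem_lowerPart x).imp fun i hi => C.lowerPart_mono (Nat.le_succ i) hi
  refine ⟨φ, C.bijective_of_unipotent φ fun i x => ?_, fun j x hx => ?_, fun x => ?_⟩
  · obtain ⟨ψ, hψ, hψφ⟩ := hφ i
    rw [hψφ _ (C.incl_mem_lowerPart (Nat.lt_succ_self i) x)]
    exact hψ.2.1 i x
  · obtain ⟨i, hi⟩ := hlim x
    obtain ⟨ψ, hψ, hψφ⟩ := hφ i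
    rw [hψφ x hi]
    exact hψ.1 j x hx
  · obtain ⟨i, hi⟩ := hlim x
    obtain ⟨ψ, hψ, hψφ⟩ := hφ i
    rw [hψφ x hi, hψφ _ (C.lowerPart_mono (Nat.le_succ i) (hD.map_lowerPart hi))]
    exact (hψ.2.2 x hi).1

end IsAnchoredDifferential

end GradedFreeComplex

/-! ### Rigidity from Ext vanishing, and independence of the resolution. -/

namespace GradedFreeComplex

variable {k S : Type u} [Field k] [CommRing S] [Algebra k S] {𝒜 : ℕ → Submodule k S}
  (C : GradedFreeComplex 𝒜)
  {M : Type u} [AddCommGroup M] [Module S M] {P : ℤ → AddSubgroup M}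

/-- A free flag anchored on `C` is isomorphic to `⨁ i, C.X i (i * a)` with some differential. -/
theorem exists_anchoredDifferential {a : ℤ} {G : FreeFlag 𝒜 a} (hG : G.IsAnchoredOn C) :
    ∃ (E : DirectSum ℕ C.X ≃ₗ[S] G.D) (D : DirectSum ℕ C.X →ₗ[S] DirectSum ℕ C.X),
      C.IsAnchoredDifferential a D ∧ (∀ j x, x ∈ C.foldDeg a j ↔ E x ∈ G.deg j) ∧
      ∀ x, E (D x) = G.d (E x) := by
  obtain ⟨e, hdeg, hd⟩ := hG
  let E : DirectSum ℕ C.X ≃ₗ[S] G.D := (DFinsupp.mapRange.linearEquiv e).trans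
    (LinearEquiv.ofBijective (DirectSum.coeLinearMap G.F) G.isInternal)
  have hE : ∀ i x, E (C.incl i x) = e i x := by
    intro i x
    change DirectSum.coeLinearMap G.F (DFinsupp.mapRange.linearEquiv e (DFinsupp.single i x)) = _
    rw [DFinsupp.mapRange.linearEquiv_apply, DFinsupp.mapRange_single]
    exact DirectSum.coeLinearMap_lof G.F i _
  have hEdeg : ∀ j x, x ∈ C.foldDeg a j → E x ∈ G.deg j := by
    intro j x hx
    refine C.mem_of_incl_mem ((G.deg j).comap E.toLinearMap.toAddMonoidHom) fun i => ?_
    have h1 := (hdeg i _ _).1 (hx i)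
    rw [add_sub_cancel_right, ← hE] at h1
    exact h1
  have hEdeg' : ∀ j x, E x ∈ G.deg j → x ∈ C.foldDeg a j := fun j x hx =>
    (C.foldDeg_isGrading a).mem_of_map_mem G.isGrading (g := E.toLinearMap) (c := 0)
      (fun j x hx => by rw [add_zero]; exact hEdeg j x hx) E.injective (by rwa [add_zero])
  have hlow : ∀ i, ∀ y ∈ (⨆ j : Fin i, G.F j), E.symm y ∈ C.lowerPart i := by
    intro i y hy
    refine (iSup_le fun j y hy => ?_ :
      (⨆ j : Fin i, G.F j) ≤ (C.lowerPart i).comap E.symm.toLinearMap) hy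
    have h1 : E.symm y = C.incl j ((e j).symm ⟨y, hy⟩) := by
      rw [LinearEquiv.symm_apply_eq, hE, LinearEquiv.apply_symm_apply]
    change E.symm y ∈ C.lowerPart i
    rw [h1]
    exact C.incl_mem_lowerPart j.2 _
  refine ⟨E, E.symm.toLinearMap ∘ₗ G.d ∘ₗ E.toLinearMap, ⟨fun x => ?_, fun j x hx => ?_, fun x => ?_,
    fun i x => ?_⟩, fun j x => ⟨hEdeg j x, hEdeg' j x⟩, fun x => ?_⟩
  · simp only [LinearMap.comp_apply, LinearEquiv.coe_coe, LinearEquiv.apply_symm_apply]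
    have := LinearMap.congr_fun G.d_comp_d (E x)
    rw [LinearMap.comp_apply] at this
    rw [this, LinearMap.zero_apply, map_zero]
  · refine hEdeg' _ _ ?_
    simp only [LinearMap.comp_apply, LinearEquiv.coe_coe, LinearEquiv.apply_symm_apply]
    exact G.d_mem _ _ (hEdeg _ _ hx)
  · simp only [LinearMap.comp_apply, LinearEquiv.coe_coe, hE]
    have := G.d_mem_iSup 0 _ (e 0 x).2
    rw [iSup_of_empty, Submodule.mem_bot] at this
    rw [this, map_zero]
  · have := hlow i _ (hd i x)
    rwa [map_sub, ← hE, ← hE, LinearEquiv.symm_apply_apply] at this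
  · simp only [LinearMap.comp_apply, LinearEquiv.coe_coe, LinearEquiv.apply_symm_apply]

variable [GradedAlgebra 𝒜]

/-- A resolution of `M` is `a`-rigid if the groups `Ext^p(M, M)` vanish in degree `-(p - 1) * a` for
all `p ≥ 2`. -/
theorem isRigid_of_extVanishes (hP : IsModuleGrading 𝒜 P) (hC : C.IsResolutionOf M P) {a : ℤ}
    (hext : C.ExtVanishes a M P) : C.IsRigid a := by
  intro G hG
  obtain ⟨E, D, hD, hE, hED⟩ := C.exists_anchoredDifferential hG
  obtain ⟨ε, hε, hsurj, hεd, hex⟩ := hC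
  obtain ⟨π, hπ, hπ0, hπD⟩ :=
    hD.exists_augmentation hε (fun x => (hεd _).2 ⟨x, rfl⟩) hext
  obtain ⟨φ, hφ, hφdeg, hφD⟩ := hD.exists_isomorphism hP hε hsurj hεd hex hπ hπ0 hπD
  let Ψ : G.D ≃ₗ[S] DirectSum ℕ C.X := E.symm.trans (LinearEquiv.ofBijective φ hφ)
  have hΨ : ∀ x, Ψ (E x) = φ x := fun x => congrArg φ (E.symm_apply_apply x)
  refine ⟨Ψ, fun j x => ?_, fun x => ?_⟩
  · obtain ⟨x, rfl⟩ := E.surjective x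
    change _ ↔ Ψ (E x) ∈ C.foldDeg a j
    rw [← hE, hΨ]
    exact ⟨hφdeg j x, fun h => (C.foldDeg_isGrading a).mem_of_map_mem (C.foldDeg_isGrading a)
      (c := 0) (fun j x hx => by rw [add_zero]; exact hφdeg j x hx) hφ.1 (by rwa [add_zero])⟩
  · obtain ⟨x, rfl⟩ := E.surjective x
    change Ψ _ = C.foldD (Ψ (E x))
    rw [← hED, hΨ, hΨ, hφD]

/-- Homogeneous chain maps into a resolution can be constructed step by step. -/
theorem exists_chainMap (hP : IsModuleGrading 𝒜 P) {K : GradedFreeComplex 𝒜}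
    {εC : C.X 0 →ₗ[S] M} (hεC : ∀ j x, x ∈ C.deg 0 j → εC x ∈ P j) (hCd : ∀ x, εC (C.d 0 x) = 0)
    {εK : K.X 0 →ₗ[S] M} (hεK : ∀ j x, x ∈ K.deg 0 j → εK x ∈ P j)
    (hsurj : Function.Surjective εK) (hKd : Function.Exact (K.d 0) εK)
    (hex : ∀ i, Function.Exact (K.d (i + 1)) (K.d i)) :
    ∃ α : ∀ i, C.X i →ₗ[S] K.X i, (∀ i j x, x ∈ C.deg i j → α i x ∈ K.deg i j) ∧
      (∀ x, εK (α 0 x) = εC x) ∧ ∀ i x, K.d i (α (i + 1) x) = α i (C.d i x) := by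
  -- In positive degree the invariant only records that `α ∘ d` lands in cycles, which is what the
  -- next lift requires.
  obtain ⟨α, hα, hαd⟩ := exists_dependent_seq (T := fun i => C.X i →ₗ[S] K.X i)
    (fun i α => (∀ j x, x ∈ C.deg i j → α x ∈ K.deg i j) ∧
      match i, α with
      | 0, α => ∀ x, εK (α x) = εC x
      | i + 1, α => ∀ x, K.d i (α (C.d (i + 1) x)) = 0)
    (fun i α β => ∀ x, K.d i (β x) = α (C.d i x))
    (by
      obtain ⟨l, -, hl, hlε⟩ := (C.isGrading 0).exists_lift (K.isGrading 0) (C.exists_basis 0) ⊤ εK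
        εC 0 (fun j x hx => by
          obtain ⟨y, hy, hyx⟩ := (K.isGrading 0).exists_mem_eq hP (c := 0)
            (fun j x hx => by rw [add_zero]; exact hεK j x hx)
            (by rw [add_zero]; exact hεC j x hx) (hsurj _)
          exact ⟨y, trivial, by rwa [add_zero], hyx⟩)
      exact ⟨l, fun j x hx => by simpa using hl j x hx, hlε⟩)
    (by
      rintro i α ⟨hα, hα'⟩
      obtain ⟨l, -, hl, hlε⟩ := (C.isGrading (i + 1)).exists_lift (K.isGrading (i + 1))
        (C.exists_basis (i + 1)) ⊤ (K.d i) (α ∘ₗ C.d i) 0 (fun j x hx => by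
          obtain ⟨y, hy, hyx⟩ := (K.isGrading (i + 1)).exists_mem_eq (K.isGrading i) (c := 0)
            (fun j x hx => by rw [add_zero]; exact K.d_mem i j x hx)
            (by rw [add_zero]; exact hα j _ (C.d_mem i j x hx))
            (y := α (C.d i x)) (by
              cases i with
              | zero => exact (hKd _).1 (by rw [hα', hCd])
              | succ i => exact (hex i _).1 (hα' x))
          exact ⟨y, trivial, by rwa [add_zero], hyx⟩)
      refine ⟨l, ⟨fun j x hx => by simpa using hl j x hx, fun x => ?_⟩, hlε⟩
      rw [hlε, LinearMap.comp_apply]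
      have := LinearMap.congr_fun (C.d_comp_d i) x
      rw [LinearMap.comp_apply] at this
      rw [this, LinearMap.zero_apply, map_zero])
  exact ⟨α, fun i => (hα i).1, (hα 0).2, hαd⟩

/-- A chain endomorphism of a resolution which covers zero is null-homotopic. -/
theorem exists_homotopy {ε : C.X 0 →ₗ[S] M} (hεd : Function.Exact (C.d 0) ε)
    (hex : ∀ i, Function.Exact (C.d (i + 1)) (C.d i)) (γ : ∀ i, C.X i →ₗ[S] C.X i)
    (hγ : ∀ i j x, x ∈ C.deg i j → γ i x ∈ C.deg i j) (hγ0 : ∀ x, ε (γ 0 x) = 0)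
    (hγd : ∀ i x, C.d i (γ (i + 1) x) = γ i (C.d i x)) :
    ∃ h : ∀ i, C.X i →ₗ[S] C.X (i + 1), (∀ i j x, x ∈ C.deg i j → h i x ∈ C.deg (i + 1) j) ∧
      ∀ i x, C.d (i + 1) (h (i + 1) x) = γ (i + 1) x - h i (C.d i x) := by
  have lift : ∀ i (g : C.X i →ₗ[S] C.X i), (∀ j x, x ∈ C.deg i j → g x ∈ C.deg i j) →
      (∀ x, g x ∈ LinearMap.range (C.d i)) → ∃ l : C.X i →ₗ[S] C.X (i + 1),
        (∀ j x, x ∈ C.deg i j → l x ∈ C.deg (i + 1) j) ∧ ∀ x, C.d i (l x) = g x := by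
    intro i g hg hgr
    obtain ⟨l, -, hl, hlε⟩ := (C.isGrading i).exists_lift (C.isGrading (i + 1))
      (C.exists_basis i) ⊤ (C.d i) g 0 (fun j x hx => by
        obtain ⟨y, hy, hyx⟩ := (C.isGrading (i + 1)).exists_mem_eq (C.isGrading i) (c := 0)
          (fun j x hx => by rw [add_zero]; exact C.d_mem i j x hx)
          (by rw [add_zero]; exact hg j x hx) (hgr x)
        exact ⟨y, trivial, by rwa [add_zero], hyx⟩)
    exact ⟨l, fun j x hx => by simpa using hl j x hx, hlε⟩
  -- The invariant `d h d = γ d` is exactly what makes `γ - h d` map to cycles in the next degree.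
  obtain ⟨h, hh, hhd⟩ := exists_dependent_seq (T := fun i => C.X i →ₗ[S] C.X (i + 1))
    (fun i h => (∀ j x, x ∈ C.deg i j → h x ∈ C.deg (i + 1) j) ∧
      ∀ x, C.d i (h (C.d i x)) = γ i (C.d i x))
    (fun i h h' => ∀ x, C.d (i + 1) (h' x) = γ (i + 1) x - h (C.d i x))
    (by
      obtain ⟨l, hl, hld⟩ := lift 0 (γ 0) (hγ 0) fun x => (hεd _).1 (hγ0 x)
      exact ⟨l, hl, fun x => hld _⟩)
    (by
      rintro i h ⟨hh, hhd⟩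
      obtain ⟨l, hl, hld⟩ := lift (i + 1) (γ (i + 1) - h ∘ₗ C.d i)
        (fun j x hx => sub_mem (hγ _ _ _ hx) (hh _ _ (C.d_mem _ _ _ hx)))
        (fun x => (hex i _).1 (by
          rw [LinearMap.sub_apply, map_sub, hγd, LinearMap.comp_apply, hhd, sub_self]))
      refine ⟨l, ⟨hl, fun x => ?_⟩, hld⟩
      have := LinearMap.congr_fun (C.d_comp_d i) x
      rw [LinearMap.comp_apply, LinearMap.zero_apply] at this
      rw [hld, LinearMap.sub_apply, LinearMap.comp_apply, this, map_zero, sub_zero])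
  exact ⟨h, fun i => (hh i).1, hhd⟩

/-- If some resolution has no cochains in the relevant degrees, every resolution satisfies
`ExtVanishes`. -/
theorem IsResolutionOf.extVanishes (hP : IsModuleGrading 𝒜 P) {C K : GradedFreeComplex 𝒜}
    (hC : C.IsResolutionOf M P) (hK : K.IsResolutionOf M P) {a : ℤ}
    (hzero : ∀ p, ∃ (r : ℕ) (b : Module.Basis (Fin r) S (K.X (p + 2))), ∀ t, ∃ j,
      b t ∈ K.deg (p + 2) j ∧ P (j + -((p + 1 : ℕ) * a)) = ⊥) : C.ExtVanishes a M P := by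
  obtain ⟨εC, hεC, hCs, hCd, hCex⟩ := hC
  obtain ⟨εK, hεK, hKs, hKd, hKex⟩ := hK
  have hC0 : ∀ x, εC (C.d 0 x) = 0 := fun x => (hCd _).2 ⟨x, rfl⟩
  obtain ⟨α, hα, hαε, hαd⟩ := C.exists_chainMap hP hεC hC0 hεK hKs hKd hKex
  obtain ⟨β, hβ, hβε, hβd⟩ := K.exists_chainMap hP hεK (fun x => (hKd _).2 ⟨x, rfl⟩) hεC hCs hCd hCex
  -- `id - β α` covers the zero map of `M`.
  obtain ⟨h, hh, hhd⟩ := C.exists_homotopy hCd hCex (fun i => LinearMap.id - β i ∘ₗ α i)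
    (fun i j x hx => sub_mem hx (hβ _ _ _ (hα _ _ _ hx)))
    (fun x => by
      rw [LinearMap.sub_apply, map_sub, LinearMap.comp_apply, hβε, hαε, LinearMap.id_apply, sub_self])
    (fun i x => by
      simp only [LinearMap.sub_apply, LinearMap.comp_apply, LinearMap.id_apply, map_sub, hβd, hαd])
  intro p θ hθ hθd
  -- The pulled-back cocycle sends each generator of `K` into a zero component of `M`.
  have hθβ : θ ∘ₗ β (p + 2) = 0 := by
    obtain ⟨r, b, hb⟩ := hzero p
    refine b.ext fun t => ?_
    obtain ⟨j, hj, hPj⟩ := hb t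
    have := hθ _ _ (hβ _ _ _ hj)
    rwa [hPj, AddSubgroup.mem_bot] at this
  -- Since `θ β = 0` and `θ d = 0`, applying `θ` to `id - β α = d h + h d` gives `θ = θ h d`.
  refine ⟨θ ∘ₗ h (p + 1), fun j x hx => hθ _ _ (hh _ _ _ hx), fun x => ?_⟩
  have h1 := congrArg θ (hhd (p + 1) x)
  rw [hθd, map_sub, LinearMap.sub_apply, map_sub, LinearMap.id_apply] at h1
  have h2 : θ ((β (p + 1 + 1) ∘ₗ α (p + 1 + 1)) x) = 0 := LinearMap.congr_fun hθβ _
  rw [h2, sub_zero, eq_comm, sub_eq_zero] at h1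
  exact h1.symm

end GradedFreeComplex

/-! ### The grading on a quotient ring and homogeneous bases. -/

section

variable {k S : Type u} [Field k] [CommRing S] [Algebra k S] {𝒜 : ℕ → Submodule k S}

theorem mem_quotientGrading_natCast {I : Ideal S} {j : ℕ} {x : S ⧸ I} :
    x ∈ quotientGrading 𝒜 I j ↔ ∃ s ∈ 𝒜 j, Ideal.Quotient.mk I s = x := by
  rw [quotientGrading, if_pos (Int.natCast_nonneg j), Int.toNat_natCast]
  rfl

theorem quotientGrading_of_neg {I : Ideal S} {j : ℤ} (hj : j < 0) :
    quotientGrading 𝒜 I j = ⊥ :=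
  if_neg (by omega)

theorem exists_of_mem_quotientGrading {I : Ideal S} {j : ℤ} {x : S ⧸ I}
    (hx : x ∈ quotientGrading 𝒜 I j) : ∃ s, (s = 0 ∨ 0 ≤ j ∧ s ∈ 𝒜 j.toNat) ∧
      Ideal.Quotient.mk I s = x := by
  by_cases hj : 0 ≤ j
  · lift j to ℕ using hj
    obtain ⟨s, hs, rfl⟩ := mem_quotientGrading_natCast.1 hx
    exact ⟨s, Or.inr ⟨by omega, by simpa using hs⟩, rfl⟩
  · rw [quotientGrading_of_neg (by omega), AddSubgroup.mem_bot] at hx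
    exact ⟨0, Or.inl rfl, by rw [hx, map_zero]⟩

theorem mk_mem_quotientGrading {I : Ideal S} {j : ℕ} {s : S} (hs : s ∈ 𝒜 j) :
    Ideal.Quotient.mk I s ∈ quotientGrading 𝒜 I j :=
  mem_quotientGrading_natCast.2 ⟨s, hs, rfl⟩

/-- The residue class of the component of degree `m` of a representative. -/
noncomputable def quotientProj (𝒜 : ℕ → Submodule k S) [GradedAlgebra 𝒜] (I : Ideal S) (m : ℤ)
    (x : S ⧸ I) : S ⧸ I :=
  if 0 ≤ m then Ideal.Quotient.mk I (DirectSum.decompose 𝒜 (Quotient.out x) m.toNat) else 0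

/-- Two representatives differ by an element of `I`, whose components again lie in `I` by
homogeneity, so the chosen representative does not matter. -/
theorem quotientProj_mk [GradedAlgebra 𝒜] {I : Ideal S} (hI : I.IsHomogeneous 𝒜) (m : ℤ) (s : S) :
    quotientProj 𝒜 I m (Ideal.Quotient.mk I s) =
      if 0 ≤ m then Ideal.Quotient.mk I (DirectSum.decompose 𝒜 s m.toNat) else 0 := by
  rw [quotientProj]
  split_ifs with hm
  · rw [Ideal.Quotient.mk_eq_mk_iff_sub_mem]
    have h1 : Quotient.out (Ideal.Quotient.mk I s) - s ∈ I := by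
      rw [← Ideal.Quotient.mk_eq_mk_iff_sub_mem]
      exact Quotient.out_eq _
    have h2 := hI m.toNat h1
    rwa [DirectSum.decompose_sub, DirectSum.sub_apply, AddSubgroupClass.coe_sub] at h2
  · rfl

theorem quotientGrading_isModuleGrading [GradedAlgebra 𝒜] {I : Ideal S}
    (hI : I.IsHomogeneous 𝒜) : IsModuleGrading 𝒜 (quotientGrading 𝒜 I) where
  isInternal := by
    refine isInternal_of_proj (fun m =>
      { toFun := quotientProj 𝒜 I m
        map_zero' := by
          rw [← map_zero (Ideal.Quotient.mk I), quotientProj_mk hI]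
          simp
        map_add' := fun x y => by
          obtain ⟨s, rfl⟩ := Ideal.Quotient.mk_surjective x
          obtain ⟨t, rfl⟩ := Ideal.Quotient.mk_surjective y
          rw [← map_add, quotientProj_mk hI, quotientProj_mk hI, quotientProj_mk hI]
          split_ifs <;> simp }) ?_ ?_ ?_
    · intro m x hx
      obtain ⟨s, hs, rfl⟩ := exists_of_mem_quotientGrading hx
      change quotientProj 𝒜 I m _ = _
      rw [quotientProj_mk hI]
      rcases hs with rfl | ⟨hm, hs⟩
      · simp
      · rw [if_pos hm, DirectSum.decompose_of_mem_same _ hs]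
    · intro m m' x hx hm
      obtain ⟨s, hs, rfl⟩ := exists_of_mem_quotientGrading hx
      change quotientProj 𝒜 I m' _ = _
      rw [quotientProj_mk hI]
      rcases hs with rfl | ⟨hm0, hs⟩
      · simp
      · split_ifs with hm'
        · rw [DirectSum.decompose_of_mem_ne _ hs (by omega), map_zero]
        · rfl
    · intro x
      obtain ⟨s, rfl⟩ := Ideal.Quotient.mk_surjective x
      induction s using DirectSum.Decomposition.inductionOn 𝒜 with
      | zero => rw [map_zero]; exact zero_mem _
      | add s t hs ht => rw [map_add]; exact add_mem hs ht
      | homogeneous s => exact AddSubgroup.mem_iSup_of_mem _ (mk_mem_quotientGrading s.2)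
  smul_mem i j s x hs hx := by
    obtain ⟨t, ht, rfl⟩ := exists_of_mem_quotientGrading hx
    rw [← Ideal.Quotient.mk_eq_mk, ← Submodule.Quotient.mk_smul, Ideal.Quotient.mk_eq_mk]
    rcases ht with rfl | ⟨hj, ht⟩
    · rw [smul_zero, map_zero]
      exact zero_mem _
    · lift j to ℕ using hj
      have := mk_mem_quotientGrading (I := I) (SetLike.mul_mem_graded hs ht)
      rwa [Int.toNat_natCast, Nat.cast_add] at this

/-- There is a finite basis of homogeneous elements whose degrees lie in `A`. -/
def HasHomogeneousBasis (S : Type u) [CommRing S] {M : Type u} [AddCommGroup M] [Module S M]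
    (P : ℤ → AddSubgroup M) (A : Set ℤ) : Prop :=
  ∃ (r : ℕ) (b : Module.Basis (Fin r) S M), ∀ t, ∃ j ∈ A, b t ∈ P j

namespace HasHomogeneousBasis

variable {M N : Type u} [AddCommGroup M] [Module S M] [AddCommGroup N] [Module S N]
  {P : ℤ → AddSubgroup M} {Q : ℤ → AddSubgroup N} {A B : Set ℤ}

theorem mono (h : HasHomogeneousBasis S P A) (hAB : A ⊆ B) : HasHomogeneousBasis S P B := by
  obtain ⟨r, b, hb⟩ := h
  exact ⟨r, b, fun t => (hb t).imp fun j hj => ⟨hAB hj.1, hj.2⟩⟩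

theorem prod (hP : HasHomogeneousBasis S P A) (hQ : HasHomogeneousBasis S Q B) :
    HasHomogeneousBasis S (fun m => (P m).prod (Q m)) (A ∪ B) := by
  obtain ⟨r, b, hb⟩ := hP
  obtain ⟨r', b', hb'⟩ := hQ
  refine ⟨r + r', (b.prod b').reindex finSumFinEquiv, fun t => ?_⟩
  obtain ⟨t, rfl⟩ := finSumFinEquiv.surjective t
  rw [Module.Basis.reindex_apply, Equiv.symm_apply_apply]
  rcases t with t | t
  · obtain ⟨j, hj, hbj⟩ := hb t
    exact ⟨j, Or.inl hj, by
      rw [AddSubgroup.mem_prod, Module.Basis.prod_apply_inl_fst, Module.Basis.prod_apply_inl_snd]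
      exact ⟨hbj, zero_mem _⟩⟩
  · obtain ⟨j, hj, hbj⟩ := hb' t
    exact ⟨j, Or.inr hj, by
      rw [AddSubgroup.mem_prod, Module.Basis.prod_apply_inr_fst, Module.Basis.prod_apply_inr_snd]
      exact ⟨zero_mem _, hbj⟩⟩

theorem shift (hP : HasHomogeneousBasis S P A) (c : ℤ) :
    HasHomogeneousBasis S (fun m => P (m - c)) ((· + c) '' A) := by
  obtain ⟨r, b, hb⟩ := hP
  refine ⟨r, b, fun t => ?_⟩
  obtain ⟨j, hj, hbj⟩ := hb t
  exact ⟨j + c, ⟨j, hj, rfl⟩, by simpa using hbj⟩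

theorem of_subsingleton [Subsingleton M] : HasHomogeneousBasis S P A :=
  ⟨0, Module.Basis.empty M, fun t => t.elim0⟩

end HasHomogeneousBasis

/-! ### Mapping cones of multiplication by a homogeneous element. -/

namespace GradedFreeComplex

variable (C : GradedFreeComplex 𝒜)

/-- The modules of `C`, placed one homological degree higher. -/
def Tail : ℕ → Type u
  | 0 => PUnit
  | i + 1 => C.X i

instance : ∀ i, AddCommGroup (C.Tail i)
  | 0 => inferInstanceAs (AddCommGroup PUnit.{u + 1})
  | i + 1 => C.addCommGroup i

instance : ∀ i, Module S (C.Tail i)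
  | 0 => (inferInstance : Module S PUnit.{u + 1})
  | i + 1 => C.module i

instance : Subsingleton (C.Tail 0) := inferInstanceAs (Subsingleton PUnit)

/-- The identification of `C.Tail (i + 1)` with `C.X i`. -/
def tailEquiv (i : ℕ) : C.Tail (i + 1) ≃ₗ[S] C.X i := LinearEquiv.refl S (C.X i)

/-- The differential of `C`, as a differential of `C.Tail`. -/
def tailD : ∀ i, C.Tail (i + 1) →ₗ[S] C.Tail i
  | 0 => 0
  | i + 1 => (C.tailEquiv i).symm.toLinearMap ∘ₗ C.d i ∘ₗ (C.tailEquiv (i + 1)).toLinearMap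

/-- The grading of `C.Tail`, shifted by `e`. -/
def tailDeg (e : ℤ) : ∀ i, ℤ → AddSubgroup (C.Tail i)
  | 0 => fun _ => ⊤
  | i + 1 => fun m => C.deg i (m - e)

theorem tailDeg_isGrading (e : ℤ) : ∀ i, IsModuleGrading 𝒜 (C.tailDeg e i)
  | 0 => .of_subsingleton
  | i + 1 => (C.isGrading i).shift e

theorem tailEquiv_mem {e : ℤ} {i : ℕ} {m : ℤ} {y : C.Tail (i + 1)} :
    C.tailEquiv i y ∈ C.deg i (m - e) ↔ y ∈ C.tailDeg e (i + 1) m := Iff.rfl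

theorem tailEquiv_tailD (i : ℕ) (y : C.Tail (i + 1 + 1)) :
    C.tailEquiv i (C.tailD (i + 1) y) = C.d i (C.tailEquiv (i + 1) y) := rfl

theorem tailD_mem {e : ℤ} : ∀ (i : ℕ) (m : ℤ) (y : C.Tail (i + 1)), y ∈ C.tailDeg e (i + 1) m →
    C.tailD i y ∈ C.tailDeg e i m
  | 0, _, _, _ => trivial
  | i + 1, m, y, hy => C.d_mem i (m - e) (C.tailEquiv (i + 1) y) hy

theorem d_d (i : ℕ) (x : C.X (i + 2)) : C.d i (C.d (i + 1) x) = 0 :=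
  LinearMap.congr_fun (C.d_comp_d i) x

theorem tailD_tailD (i : ℕ) (y : C.Tail (i + 2)) : C.tailD i (C.tailD (i + 1) y) = 0 := by
  cases i with
  | zero => rfl
  | succ i => exact C.d_d i (C.tailEquiv (i + 2) y)

theorem hasHomogeneousBasis (i : ℕ) : HasHomogeneousBasis S (C.deg i) Set.univ := by
  obtain ⟨r, b, hb⟩ := C.exists_basis i
  exact ⟨r, b, fun t => (hb t).imp fun j hj => ⟨trivial, hj⟩⟩

theorem tail_hasHomogeneousBasis (e : ℤ) : ∀ i, HasHomogeneousBasis S (C.tailDeg e i) Set.univ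
  | 0 => .of_subsingleton
  | i + 1 => ((C.hasHomogeneousBasis i).shift e).mono (Set.subset_univ _)

/-- The mapping cone of the multiplication by a homogeneous element `f` of degree `e` on `C`. -/
def cone {f : S} {e : ℕ} (hf : f ∈ 𝒜 e) : GradedFreeComplex 𝒜 where
  X i := C.X i × C.Tail i
  deg i m := (C.deg i m).prod (C.tailDeg e i m)
  isGrading i := (C.isGrading i).prod (C.tailDeg_isGrading e i)
  exists_basis i := by
    obtain ⟨r, b, hb⟩ := (C.hasHomogeneousBasis i).prod (C.tail_hasHomogeneousBasis e i)
    exact ⟨r, b, fun t => (hb t).imp fun j hj => hj.2⟩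
  d i := (C.d i ∘ₗ LinearMap.fst S _ _ +
    f • (C.tailEquiv i).toLinearMap ∘ₗ LinearMap.snd S _ _).prod (-(C.tailD i ∘ₗ LinearMap.snd S _ _))
  d_comp_d i := by
    refine LinearMap.ext fun x => Prod.ext ?_ ?_
    · change C.d i (C.d (i + 1) x.1 + f • C.tailEquiv (i + 1) x.2) +
        f • C.tailEquiv i (-(C.tailD (i + 1) x.2)) = 0
      rw [map_add, C.d_d, map_smul, map_neg, tailEquiv_tailD, smul_neg, zero_add, add_neg_cancel]
    · change -(C.tailD i (-(C.tailD (i + 1) x.2))) = 0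
      rw [map_neg, C.tailD_tailD, neg_zero, neg_zero]
  d_mem i j x hx := by
    refine ⟨add_mem (C.d_mem i j _ hx.1) ?_, 
      (C.tailDeg e i j).neg_mem (C.tailD_mem i j _ hx.2)⟩
    have := (C.isGrading i).smul_mem e _ f _ hf (C.tailEquiv_mem.2 hx.2)
    rwa [add_sub_cancel] at this

theorem cone_hasHomogeneousBasis {f : S} {e : ℕ} (hf : f ∈ 𝒜 e) {A : ℕ → Set ℤ}
    (hA : ∀ i, HasHomogeneousBasis S (C.deg i) (A i)) (i : ℕ) :
    HasHomogeneousBasis S ((C.cone hf).deg i)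
      (A i ∪ match i with
        | 0 => ∅
        | i + 1 => (· + (e : ℤ)) '' A i) := by
  refine (hA i).prod ?_
  cases i with
  | zero => exact .of_subsingleton
  | succ i => exact (hA i).shift e

/-- The homology of the cone is built from the kernel and cokernel of `f` on the homology of `C`,
which is `S ⧸ J` in degree `0`. As `f` is a nonzerodivisor there, only the cokernel `S ⧸ (J + (f))`
survives. -/
theorem cone_isResolutionOf {C : GradedFreeComplex 𝒜} {f : S} {e : ℕ} (hf : f ∈ 𝒜 e) {J : Ideal S}
    (hC : C.IsResolutionOf (S ⧸ J) (quotientGrading 𝒜 J)) (hreg : ∀ x, f * x ∈ J → x ∈ J) :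
    (C.cone hf).IsResolutionOf (S ⧸ (J ⊔ Ideal.span {f})) (quotientGrading 𝒜 (J ⊔ Ideal.span {f})) := by
  obtain ⟨ε, hε, hs, hd, hex⟩ := hC
  have hreg' : ∀ z : S ⧸ J, f • z = 0 → z = 0 := by
    intro z hz
    obtain ⟨s, rfl⟩ := Ideal.Quotient.mk_surjective z
    exact Ideal.Quotient.eq_zero_iff_mem.2 (hreg s (Ideal.Quotient.eq_zero_iff_mem.1 hz))
  have hd0 : ∀ x, ε (C.d 0 x) = 0 := fun x => (hd _).2 ⟨x, rfl⟩
  -- a cycle `(x, y)` in positive degree is determined by a lift of `y`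
  have key : ∀ i (x : C.X (i + 1)) (y : C.Tail (i + 1)) (y' : C.X (i + 1)),
      C.d i x + f • C.tailEquiv i y = 0 → C.d i y' = C.tailEquiv i y →
      ∃ w, (C.cone hf).d (i + 1) w = (x, y) := by
    intro i x y y' hx hy
    obtain ⟨x', hx'⟩ := (hex i (x + f • y')).1 (by rw [map_add, map_smul, hy, hx])
    refine ⟨(x', (C.tailEquiv (i + 1)).symm (-y')), Prod.ext ?_ ?_⟩
    · change C.d (i + 1) x' + f • C.tailEquiv (i + 1) ((C.tailEquiv (i + 1)).symm (-y')) = x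
      rw [LinearEquiv.apply_symm_apply, hx', smul_neg, add_neg_cancel_right]
    · change -(C.tailD (i + 1) ((C.tailEquiv (i + 1)).symm (-y'))) = y
      refine (C.tailEquiv i).injective ?_
      rw [map_neg, tailEquiv_tailD, LinearEquiv.apply_symm_apply, map_neg, neg_neg, hy]
  refine ⟨Submodule.factor (le_sup_left : J ≤ J ⊔ Ideal.span {f}) ∘ₗ ε ∘ₗ LinearMap.fst S _ _,
    fun j x hx => ?_, fun z => ?_, fun x => ⟨fun hx => ?_, ?_⟩, fun i x => ⟨fun hx => ?_, ?_⟩⟩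
  · obtain ⟨s, hsj, hsx⟩ := exists_of_mem_quotientGrading (hε j _ hx.1)
    change Submodule.factor (le_sup_left : J ≤ J ⊔ Ideal.span {f}) (ε x.1) ∈ _
    rw [← hsx]
    change Ideal.Quotient.mk _ s ∈ _
    rcases hsj with rfl | ⟨hj, hsj⟩
    · rw [map_zero]
      exact zero_mem _
    · lift j to ℕ using hj
      exact mk_mem_quotientGrading (by simpa using hsj)
  · obtain ⟨s, rfl⟩ := Ideal.Quotient.mk_surjective z
    obtain ⟨x, hx⟩ := hs (Ideal.Quotient.mk J s)
    refine ⟨(x, 0), ?_⟩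
    change Submodule.factor (le_sup_left : J ≤ J ⊔ Ideal.span {f}) (ε x) = _
    rw [hx]
    rfl
  · obtain ⟨x, y⟩ := x
    change Submodule.factor (le_sup_left : J ≤ J ⊔ Ideal.span {f}) (ε x) = _ at hx
    obtain ⟨s, hsx⟩ := Ideal.Quotient.mk_surjective (ε x)
    rw [← hsx] at hx
    have hs' : s ∈ J ⊔ Ideal.span {f} := Ideal.Quotient.eq_zero_iff_mem.1 hx
    obtain ⟨g, hg, h, hh, rfl⟩ := Submodule.mem_sup.1 hs'
    obtain ⟨r, rfl⟩ := Ideal.mem_span_singleton'.1 hh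
    obtain ⟨w, hw⟩ := hs (Ideal.Quotient.mk J r)
    obtain ⟨v, hv⟩ := (hd (x - f • w)).1 (by
      rw [map_sub, map_smul, hw, ← hsx, map_add, Ideal.Quotient.eq_zero_iff_mem.2 hg, zero_add,
        sub_eq_zero, mul_comm]
      rfl)
    refine ⟨(v, (C.tailEquiv 0).symm w), Prod.ext ?_ (Subsingleton.elim (α := C.Tail 0) _ _)⟩
    change C.d 0 v + f • C.tailEquiv 0 ((C.tailEquiv 0).symm w) = x
    rw [LinearEquiv.apply_symm_apply, hv, sub_add_cancel]
  · rintro ⟨⟨x, y⟩, rfl⟩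
    change Submodule.factor (le_sup_left : J ≤ J ⊔ Ideal.span {f})
      (ε (C.d 0 x + f • C.tailEquiv 0 y)) = 0
    obtain ⟨s, hs⟩ := Ideal.Quotient.mk_surjective (ε (C.tailEquiv 0 y))
    rw [map_add, hd0, zero_add, map_smul, ← hs]
    exact Ideal.Quotient.eq_zero_iff_mem.2 (Ideal.mul_mem_right _ _
      (le_sup_right (a := J) (Ideal.mem_span_singleton_self f)))
  · obtain ⟨x, y⟩ := x
    have h1 : C.d i x + f • C.tailEquiv i y = 0 := congrArg Prod.fst hx
    have h2 : -(C.tailD i y) = 0 := congrArg Prod.snd hx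
    rw [neg_eq_zero] at h2
    -- Regularity enters only in homological degree `1`: there `f • ε y = 0`, hence `ε y = 0`. Above
    -- it, `y` is a cycle of the exact part of `C`.
    have h3 : ∃ y', C.d i y' = C.tailEquiv i y := by
      cases i with
      | zero =>
        refine (hd _).1 (hreg' _ ?_)
        have := congrArg ε h1
        rwa [map_add, hd0, zero_add, map_smul, map_zero] at this
      | succ i =>
        refine (hex i _).1 ?_
        rw [← tailEquiv_tailD, h2, map_zero]
    obtain ⟨y', hy'⟩ := h3
    exact key i x y y' h1 hy'
  · rintro ⟨w, rfl⟩
    exact (C.cone hf).d_d i w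

end GradedFreeComplex

end

/-! ### The iterated cone resolving a regular sequence. -/

section

variable {k S : Type u} [Field k] [CommRing S] [Algebra k S] {𝒜 : ℕ → Submodule k S}

/-- The ideal generated by the first `r` members of the family `f`. -/
def initialIdeal {n : ℕ} (f : Fin n → S) (r : ℕ) : Ideal S :=
  Ideal.span (f '' {t | t.val < r})

theorem initialIdeal_zero {n : ℕ} (f : Fin n → S) : initialIdeal f 0 = ⊥ := by
  simp [initialIdeal]

theorem initialIdeal_succ {n : ℕ} (f : Fin n → S) (i : Fin n) :
    initialIdeal f (i + 1) = initialIdeal f i ⊔ Ideal.span {f i} := by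
  rw [initialIdeal, initialIdeal, ← Ideal.span_union, ← Set.image_singleton, ← Set.image_union]
  congr 2
  ext t
  simp only [Set.mem_ofPred_eq, Set.mem_union, Set.mem_singleton_iff, Fin.ext_iff]
  omega

theorem initialIdeal_self {n : ℕ} (f : Fin n → S) :
    initialIdeal f n = Ideal.span (Set.range f) := by
  rw [initialIdeal, ← Set.image_univ]
  congr 2
  ext t
  simp

theorem initialIdeal_isHomogeneous [GradedAlgebra 𝒜] {n : ℕ} {f : Fin n → S} {d : Fin n → ℕ}
    (hf : ∀ i, f i ∈ 𝒜 (d i)) (r : ℕ) : (initialIdeal f r).IsHomogeneous 𝒜 := by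
  refine Ideal.homogeneous_span 𝒜 _ ?_
  rintro _ ⟨i, -, rfl⟩
  exact ⟨d i, hf i⟩

namespace GradedFreeComplex

/-- The modules of the complex with the single module `S` in homological degree `0`. -/
def RankOneX (S : Type u) [CommRing S] : ℕ → Type u
  | 0 => S ⧸ (⊥ : Ideal S)
  | _ + 1 => PUnit

instance : ∀ i, AddCommGroup (RankOneX S i)
  | 0 => inferInstanceAs (AddCommGroup (S ⧸ (⊥ : Ideal S)))
  | _ + 1 => inferInstanceAs (AddCommGroup PUnit.{u + 1})

instance : ∀ i, Module S (RankOneX S i)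
  | 0 => (inferInstance : Module S (S ⧸ (⊥ : Ideal S)))
  | _ + 1 => (inferInstance : Module S PUnit.{u + 1})

instance (i : ℕ) : Subsingleton (RankOneX S (i + 1)) := inferInstanceAs (Subsingleton PUnit)

/-- The grading of `RankOneX S`. -/
def rankOneDeg (𝒜 : ℕ → Submodule k S) : ∀ i, ℤ → AddSubgroup (RankOneX S i)
  | 0 => quotientGrading 𝒜 ⊥
  | _ + 1 => fun _ => ⊤

/-- The ring is modelled as `S ⧸ ⊥` so that `quotientGrading` supplies its `ℤ`-grading and the
augmentation of `rankOne` is the identity. -/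
theorem quotient_bot_hasHomogeneousBasis [GradedAlgebra 𝒜] :
    HasHomogeneousBasis S (quotientGrading 𝒜 (⊥ : Ideal S)) {0} := by
  refine ⟨1, (Module.Basis.singleton (Fin 1) S).map
    (Submodule.quotEquivOfEqBot (⊥ : Ideal S) rfl).symm, fun t => ⟨0, rfl, ?_⟩⟩
  rw [Module.Basis.map_apply, Module.Basis.singleton_apply]
  exact mk_mem_quotientGrading (j := 0) SetLike.GradedOne.one_mem

theorem rankOne_hasHomogeneousBasis [GradedAlgebra 𝒜] : ∀ i,
    HasHomogeneousBasis S (rankOneDeg 𝒜 i) {j | i = 0 ∧ j = 0}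
  | 0 => quotient_bot_hasHomogeneousBasis.mono fun _ hj => ⟨rfl, hj⟩
  | _ + 1 => .of_subsingleton

/-- The resolution of `S` by itself. -/
def rankOne (𝒜 : ℕ → Submodule k S) [GradedAlgebra 𝒜] : GradedFreeComplex 𝒜 where
  X := RankOneX S
  deg := rankOneDeg 𝒜
  isGrading
    | 0 => quotientGrading_isModuleGrading (Ideal.IsHomogeneous.bot 𝒜)
    | _ + 1 => .of_subsingleton
  exists_basis i := by
    obtain ⟨r, b, hb⟩ := rankOne_hasHomogeneousBasis (𝒜 := 𝒜) i
    exact ⟨r, b, fun t => (hb t).imp fun j hj => hj.2⟩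
  d _ := 0
  d_comp_d _ := LinearMap.comp_zero _
  d_mem _ _ _ _ := zero_mem _

theorem rankOne_isResolutionOf [GradedAlgebra 𝒜] :
    (rankOne 𝒜).IsResolutionOf (S ⧸ (⊥ : Ideal S)) (quotientGrading 𝒜 ⊥) := by
  refine ⟨(LinearMap.id : (S ⧸ (⊥ : Ideal S)) →ₗ[S] _), fun j x hx => hx, fun x => ⟨x, rfl⟩,
    fun x => ⟨fun hx => ⟨0, hx.symm⟩, ?_⟩,
    fun i x => ⟨fun _ => ⟨0, Subsingleton.elim (α := RankOneX S (i + 1)) _ _⟩, fun _ => rfl⟩⟩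
  rintro ⟨y, rfl⟩
  rfl

/-- A regular sequence of homogeneous elements yields an iterated mapping cone resolving the
quotient; its generators in homological degree `p` have the sums of `p` degrees as degrees. -/
theorem exists_resolution [GradedAlgebra 𝒜] {n : ℕ} {f : Fin n → S} {d : Fin n → ℕ}
    (hf : ∀ i, f i ∈ 𝒜 (d i))
    (hreg : ∀ (i : Fin n) (x : S), f i * x ∈ initialIdeal f i → x ∈ initialIdeal f i) (r : ℕ)
    (hr : r ≤ n) :
    ∃ C : GradedFreeComplex 𝒜,
      C.IsResolutionOf (S ⧸ initialIdeal f r) (quotientGrading 𝒜 (initialIdeal f r)) ∧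
      ∀ p, HasHomogeneousBasis S (C.deg p)
        {j | ∃ T : Finset (Fin n), (∀ t ∈ T, t.val < r) ∧ T.card = p ∧ ∑ t ∈ T, (d t : ℤ) = j} := by
  induction r with
  | zero =>
    rw [initialIdeal_zero]
    refine ⟨rankOne 𝒜, rankOne_isResolutionOf, fun p => (rankOne_hasHomogeneousBasis p).mono ?_⟩
    rintro j ⟨rfl, rfl⟩
    exact ⟨∅, by simp⟩
  | succ r ih =>
    obtain ⟨C, hC, hCb⟩ := ih (by omega)
    have hs := initialIdeal_succ f ⟨r, hr⟩
    rw [hs]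
    refine ⟨C.cone (hf ⟨r, hr⟩), cone_isResolutionOf _ hC (hreg ⟨r, hr⟩), fun p =>
      (C.cone_hasHomogeneousBasis (hf ⟨r, hr⟩) hCb p).mono ?_⟩
    -- Generators of the old complex keep their index set; those of the shifted copy acquire the new
    -- index `r`.
    rintro j (⟨T, hT, hTp, rfl⟩ | hj)
    · exact ⟨T, fun t ht => (hT t ht).trans (Nat.lt_succ_self r), hTp, rfl⟩
    · cases p with
      | zero => exact hj.elim
      | succ p =>
        obtain ⟨_, ⟨T, hT, hTp, rfl⟩, rfl⟩ := hj
        have hrT : (⟨r, hr⟩ : Fin n) ∉ T := fun h => lt_irrefl _ (hT _ h)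
        refine ⟨insert ⟨r, hr⟩ T, fun t ht => ?_, by rw [Finset.card_insert_of_notMem hrT, hTp], ?_⟩
        · rcases Finset.mem_insert.1 ht with rfl | ht
          · exact Nat.lt_succ_self r
          · exact (hT t ht).trans (Nat.lt_succ_self r)
        · rw [Finset.sum_insert hrT]
          exact add_comm _ _

end GradedFreeComplex

/-! ### Hilbert series of quotients by regular sequences. -/

/-- The image in `S ⧸ J` of the component of degree `j`. -/
noncomputable def quotientComponent (𝒜 : ℕ → Submodule k S) (J : Ideal S) (j : ℕ) :
    Submodule k (S ⧸ J) :=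
  (𝒜 j).map (Ideal.Quotient.mkₐ k J).toLinearMap

/-- The Hilbert series of `S ⧸ J`. -/
noncomputable def hilbertSeries (𝒜 : ℕ → Submodule k S) (J : Ideal S) : PowerSeries ℤ :=
  PowerSeries.mk fun j => (Module.finrank k (quotientComponent 𝒜 J j) : ℤ)

theorem mem_quotientComponent {J : Ideal S} {j : ℕ} {x : S ⧸ J} :
    x ∈ quotientComponent 𝒜 J j ↔ ∃ s ∈ 𝒜 j, Ideal.Quotient.mk J s = x := Iff.rfl

/-- Multiplication by a nonzerodivisor on `S ⧸ J` and the Hilbert functions. -/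
theorem finrank_quotientComponent_sup [GradedAlgebra 𝒜] [∀ j, FiniteDimensional k (𝒜 j)]
    {J : Ideal S} (hJ : J.IsHomogeneous 𝒜) {f : S} {e : ℕ} (hf : f ∈ 𝒜 e)
    (hreg : ∀ x, f * x ∈ J → x ∈ J) (j : ℕ) :
    Module.finrank k (quotientComponent 𝒜 (J ⊔ Ideal.span {f}) j) +
      (if e ≤ j then Module.finrank k (quotientComponent 𝒜 J (j - e)) else 0) =
      Module.finrank k (quotientComponent 𝒜 J j) := by
  have : FiniteDimensional k (quotientComponent 𝒜 J j) := by
    unfold quotientComponent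
    infer_instance
  let u : S ⧸ J →ₗ[k] S ⧸ (J ⊔ Ideal.span {f}) :=
    (Ideal.Quotient.factorₐ k (le_sup_left : J ≤ J ⊔ Ideal.span {f})).toLinearMap
  have hu : ∀ s, u (Ideal.Quotient.mk J s) = Ideal.Quotient.mk _ s := fun s => rfl
  -- Rank-nullity for `(S ⧸ J)_j → (S ⧸ (J + (f)))_j`: it is onto, and its kernel is `f` times `(S ⧸
  -- J)_(j - e)`, or zero when `j < e`.
  rw [← LinearMap.finrank_range_add_finrank_ker (u.domRestrict (quotientComponent 𝒜 J j))]
  congr 1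
  · have hrange : LinearMap.range (u.domRestrict (quotientComponent 𝒜 J j)) =
        quotientComponent 𝒜 (J ⊔ Ideal.span {f}) j := ?_
    · rw [hrange]
    rw [LinearMap.range_domRestrict]
    ext x
    constructor
    · rintro ⟨y, ⟨s, hs, rfl⟩, rfl⟩
      exact ⟨s, hs, (hu s).symm⟩
    · rintro ⟨s, hs, rfl⟩
      exact ⟨_, ⟨s, hs, rfl⟩, hu s⟩
  · rw [← Submodule.finrank_map_subtype_eq]
    have hker : ∀ x, x ∈ (LinearMap.ker (u.domRestrict (quotientComponent 𝒜 J j))).map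
        (quotientComponent 𝒜 J j).subtype ↔ x ∈ quotientComponent 𝒜 J j ∧ u x = 0 := by
      intro x
      constructor
      · rintro ⟨y, hy, rfl⟩
        exact ⟨y.2, hy⟩
      · rintro ⟨hx, hux⟩
        exact ⟨⟨x, hx⟩, hux, rfl⟩
    -- Take degree `j` components in `s = g + r * f`; homogeneity of `J` makes the `g` part vanish
    -- modulo `J`.
    have hdec : ∀ s ∈ 𝒜 j, Ideal.Quotient.mk (J ⊔ Ideal.span {f}) s = 0 → ∃ r : S,
        Ideal.Quotient.mk J s =
          Ideal.Quotient.mk J (DirectSum.decompose 𝒜 (r * f) j) := by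
      intro s hs h0
      obtain ⟨g, hg, h, hh, hsum⟩ := Submodule.mem_sup.1 (Ideal.Quotient.eq_zero_iff_mem.1 h0)
      obtain ⟨r, rfl⟩ := Ideal.mem_span_singleton'.1 hh
      refine ⟨r, ?_⟩
      have h1 : (DirectSum.decompose 𝒜 g j : S) ∈ J := hJ j hg
      have h2 := DirectSum.decompose_of_mem_same 𝒜 hs
      rw [← hsum, DirectSum.decompose_add, DirectSum.add_apply, Submodule.coe_add] at h2
      rw [← hsum, ← h2, map_add, Ideal.Quotient.eq_zero_iff_mem.2 h1, zero_add]
    split_ifs with he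
    · let m : S ⧸ J →ₗ[k] S ⧸ J := LinearMap.mulLeft k (Ideal.Quotient.mk J f)
      have hm : Function.Injective m := by
        rw [injective_iff_map_eq_zero]
        intro x hx
        obtain ⟨s, rfl⟩ := Ideal.Quotient.mk_surjective x
        rw [LinearMap.mulLeft_apply, ← map_mul, Ideal.Quotient.eq_zero_iff_mem] at hx
        exact Ideal.Quotient.eq_zero_iff_mem.2 (hreg s hx)
      rw [(Submodule.equivMapOfInjective m hm (quotientComponent 𝒜 J (j - e))).finrank_eq]
      have : (quotientComponent 𝒜 J (j - e)).map m =
          (LinearMap.ker (u.domRestrict (quotientComponent 𝒜 J j))).map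
            (quotientComponent 𝒜 J j).subtype := by
        ext x
        rw [hker, Submodule.mem_map]
        constructor
        · rintro ⟨y, hy, rfl⟩
          obtain ⟨s, hs, rfl⟩ := mem_quotientComponent.1 hy
          rw [LinearMap.mulLeft_apply, ← map_mul]
          refine ⟨mem_quotientComponent.2 ⟨f * s, ?_, rfl⟩, ?_⟩
          · have := SetLike.mul_mem_graded hf hs
            rwa [Nat.add_sub_of_le he] at this
          · rw [hu, Ideal.Quotient.eq_zero_iff_mem]
            exact Ideal.mul_mem_right _ _
              (le_sup_right (a := J) (Ideal.mem_span_singleton_self f))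
        · rintro ⟨hx, hux⟩
          obtain ⟨s, hs, rfl⟩ := mem_quotientComponent.1 hx
          obtain ⟨r, hr⟩ := hdec s hs hux
          rw [DirectSum.coe_decompose_mul_of_right_mem_of_le 𝒜 hf he] at hr
          refine ⟨_, mem_quotientComponent.2 ⟨_, (DirectSum.decompose 𝒜 r (j - e)).2, rfl⟩, ?_⟩
          rw [hr, LinearMap.mulLeft_apply, ← map_mul, mul_comm]
      rw [this]
    · have : (LinearMap.ker (u.domRestrict (quotientComponent 𝒜 J j))).map
          (quotientComponent 𝒜 J j).subtype = ⊥ := by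
        rw [eq_bot_iff]
        intro x hx
        obtain ⟨hx, hux⟩ := (hker x).1 hx
        obtain ⟨s, hs, rfl⟩ := mem_quotientComponent.1 hx
        obtain ⟨r, hr⟩ := hdec s hs hux
        rw [DirectSum.coe_decompose_mul_of_right_mem_of_not_le 𝒜 hf he, map_zero] at hr
        exact hr
      rw [this, finrank_bot]

theorem hilbertSeries_sup [GradedAlgebra 𝒜] [∀ j, FiniteDimensional k (𝒜 j)]
    {J : Ideal S} (hJ : J.IsHomogeneous 𝒜) {f : S} {e : ℕ} (hf : f ∈ 𝒜 e)
    (hreg : ∀ x, f * x ∈ J → x ∈ J) :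
    hilbertSeries 𝒜 (J ⊔ Ideal.span {f}) = hilbertSeries 𝒜 J * (1 - PowerSeries.X ^ e) := by
  ext j
  have h := finrank_quotientComponent_sup hJ hf hreg j
  rw [mul_sub, mul_one, map_sub, PowerSeries.coeff_mul_X_pow', hilbertSeries, hilbertSeries,
    PowerSeries.coeff_mk, PowerSeries.coeff_mk, ← h, eq_sub_iff_add_eq]
  split_ifs with he
  · rw [PowerSeries.coeff_mk]
    push_cast
    rfl
  · simp

theorem hilbertSeries_initialIdeal [GradedAlgebra 𝒜] [∀ j, FiniteDimensional k (𝒜 j)] {n : ℕ}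
    {f : Fin n → S} {d : Fin n → ℕ} (hf : ∀ i, f i ∈ 𝒜 (d i))
    (hreg : ∀ (i : Fin n) (x : S), f i * x ∈ initialIdeal f i → x ∈ initialIdeal f i) (r : ℕ)
    (hr : r ≤ n) :
    hilbertSeries 𝒜 (initialIdeal f r) = hilbertSeries 𝒜 ⊥ *
      ∏ i : Fin n with i.val < r, (1 - PowerSeries.X ^ d i) := by
  induction r with
  | zero => simp [initialIdeal_zero]
  | succ r ih =>
    have hs := initialIdeal_succ f ⟨r, hr⟩
    have hfil : (Finset.univ.filter fun i : Fin n => i.val < r + 1) =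
        insert ⟨r, hr⟩ (Finset.univ.filter fun i : Fin n => i.val < r) := by
      ext i
      simp only [Finset.mem_filter, Finset.mem_univ, true_and, Finset.mem_insert, Fin.ext_iff]
      omega
    rw [hs, hilbertSeries_sup (initialIdeal_isHomogeneous hf _) (hf _) (hreg _), hfil,
      Finset.prod_insert (by simp)]
    change hilbertSeries 𝒜 (initialIdeal f r) * _ = _
    rw [ih (by omega)]
    ring

end

/-! ### Polynomial rings: the top degree of the quotient, and linear forms. -/

namespace MvPolynomial

variable {k : Type u} [Field k] {n : ℕ}

attribute [local instance] MvPolynomial.gradedAlgebra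

instance finiteDimensional_homogeneousSubmodule (j : ℕ) :
    FiniteDimensional k (homogeneousSubmodule (Fin n) k j) :=
  Module.Finite.iff_fg.2 (homogeneousSubmodule_fg (Fin n) k j)

theorem finrank_homogeneousSubmodule (j : ℕ) :
    Module.finrank k (homogeneousSubmodule (Fin n) k j) = (n + j - 1).choose j := by
  classical
  rw [homogeneousSubmodule_eq_finsupp_supported]
  have hset : {c : Fin n →₀ ℕ | c.degree = j} = ((Finset.univ : Finset (Fin n)).finsuppAntidiag j : Set _) := by
    ext c
    simp [Finsupp.degree_eq_sum]
  rw [hset, (AddMonoidAlgebra.supportedEquivFinsupp _).finrank_eq, Module.finrank_finsupp_self]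
  refine (Fintype.card_coe _).trans ?_
  rw [Finset.card_finsuppAntidiag_nat_eq_choose, Finset.card_univ, Fintype.card_fin]

/-- Counting monomials gives `(n - 1 + j).choose (n - 1)` in degree `j`, the coefficients of `1 / (1
- X) ^ n`. -/
theorem hilbertSeries_bot (hn : 0 < n) :
    hilbertSeries (homogeneousSubmodule (Fin n) k) ⊥ * (1 - PowerSeries.X) ^ n = 1 := by
  have h : hilbertSeries (homogeneousSubmodule (Fin n) k) ⊥ =
      (PowerSeries.invOneSubPow ℤ n).val := by
    rw [PowerSeries.invOneSubPow_val_eq_mk_sub_one_add_choose_of_pos ℤ n hn]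
    ext j
    rw [hilbertSeries, PowerSeries.coeff_mk, PowerSeries.coeff_mk]
    have hinj : Function.Injective
        (Ideal.Quotient.mkₐ k (⊥ : Ideal (MvPolynomial (Fin n) k))).toLinearMap := by
      rw [injective_iff_map_eq_zero]
      intro x hx
      exact Ideal.Quotient.eq_zero_iff_mem.1 hx
    rw [quotientComponent, ← (Submodule.equivMapOfInjective _ hinj _).finrank_eq,
      finrank_homogeneousSubmodule]
    congr 1
    rw [show n + j - 1 = n - 1 + j by omega]
    exact (Nat.choose_symm_add).symm
  rw [h, ← PowerSeries.invOneSubPow_inv_eq_one_sub_pow]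
  exact (PowerSeries.invOneSubPow ℤ n).val_inv

/-- The quotient by a homogeneous regular sequence of length `n` vanishes above the degree
`∑ i, (d i - 1)`. -/
theorem mem_span_of_sum_lt (hn : 0 < n) {f : Fin n → MvPolynomial (Fin n) k} {d : Fin n → ℕ}
    (hf : ∀ i, (f i).IsHomogeneous (d i)) (hd : ∀ i, 0 < d i)
    (hreg : ∀ (i : Fin n) (x : MvPolynomial (Fin n) k),
      f i * x ∈ initialIdeal f i → x ∈ initialIdeal f i)
    {j : ℕ} (hj : ∑ i, d i < j + n) {s : MvPolynomial (Fin n) k} (hs : s.IsHomogeneous j) :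
    s ∈ Ideal.span (Set.range f) := by
  have h1 := hilbertSeries_initialIdeal (𝒜 := homogeneousSubmodule (Fin n) k) hf hreg n le_rfl
  -- One factor `1 - X` from each generator cancels the denominator `(1 - X) ^ n`, leaving a product
  -- of polynomials of degree at most `d i - 1`.
  have hgeom : ∀ i : Fin n, (1 - PowerSeries.X ^ d i : PowerSeries ℤ) =
      (1 - PowerSeries.X) * ((∑ l ∈ Finset.range (d i), Polynomial.X ^ l : Polynomial ℤ) :
        PowerSeries ℤ) := by
    intro i
    rw [← mul_neg_geom_sum]
    congr 1
    rw [← Polynomial.coeToPowerSeries.ringHom_apply, map_sum]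
    simp
  rw [Finset.filter_true_of_mem (fun i _ => i.2), Finset.prod_congr rfl fun i _ => hgeom i,
    Finset.prod_mul_distrib, Finset.prod_const, Finset.card_univ, Fintype.card_fin, ← mul_assoc,
    hilbertSeries_bot hn, one_mul] at h1
  replace h1 := h1.trans (map_prod Polynomial.coeToPowerSeries.ringHom
    (fun i : Fin n => (∑ l ∈ Finset.range (d i), Polynomial.X ^ l : Polynomial ℤ)) _).symm
  rw [Polynomial.coeToPowerSeries.ringHom_apply] at h1
  have hdeg : (∏ i, ∑ l ∈ Finset.range (d i), Polynomial.X ^ l : Polynomial ℤ).natDegree < j := by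
    refine (Polynomial.natDegree_prod_le _ _).trans_lt ?_
    have h2 : ∀ i, (∑ l ∈ Finset.range (d i), Polynomial.X ^ l : Polynomial ℤ).natDegree ≤ d i - 1 :=
      fun i => Polynomial.natDegree_sum_le_of_forall_le _ _ fun l hl => by
        rw [Polynomial.natDegree_X_pow]
        have := Finset.mem_range.1 hl
        omega
    have h3 : ∑ i, (d i - 1) + ∑ _i : Fin n, 1 = ∑ i, d i := by
      rw [← Finset.sum_add_distrib]
      exact Finset.sum_congr rfl fun i _ => Nat.sub_add_cancel (hd i)
    rw [Finset.sum_const, Finset.card_univ, Fintype.card_fin, smul_eq_mul, mul_one] at h3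
    have h4 := Finset.sum_le_sum fun (i : Fin n) (_ : i ∈ Finset.univ) => h2 i
    omega
  have h5 := congrArg (PowerSeries.coeff j) h1
  rw [Polynomial.coeff_coe, Polynomial.coeff_eq_zero_of_natDegree_lt hdeg, hilbertSeries,
    PowerSeries.coeff_mk, Nat.cast_eq_zero] at h5
  -- `finrank` is also `0` for infinite-dimensional spaces, so finiteness is needed before
  -- concluding that the component is zero.
  have : FiniteDimensional k
      (quotientComponent (homogeneousSubmodule (Fin n) k) (initialIdeal f n) j) := by
    unfold quotientComponent
    infer_instance
  have h6 := Submodule.finrank_eq_zero.1 h5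
  have h7 : Ideal.Quotient.mk (initialIdeal f n) s ∈
      quotientComponent (homogeneousSubmodule (Fin n) k) (initialIdeal f n) j := ⟨s, hs, rfl⟩
  rw [h6, Submodule.mem_bot, Ideal.Quotient.eq_zero_iff_mem, initialIdeal_self] at h7
  exact h7

/-- Restriction of a homogeneous polynomial to the line through `p`. -/
theorem aeval_C_mul_X_of_isHomogeneous {f : MvPolynomial (Fin n) k} {e : ℕ} (hf : f.IsHomogeneous e)
    (p : Fin n → k) :
    aeval (fun i => Polynomial.C (p i) * Polynomial.X) f =
      Polynomial.C (eval p f) * (Polynomial.X : Polynomial k) ^ e := by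
  rw [aeval_def, eval₂_eq', eval_eq', map_sum, Finset.sum_mul]
  refine Finset.sum_congr rfl fun c hc => ?_
  have h1 : ∑ i, c i = e := by
    rw [← hf (mem_support_iff.1 hc), Finsupp.weight_apply, Finsupp.sum_fintype _ _ (by simp)]
    simp
  simp only [mul_pow, Finset.prod_mul_distrib, Finset.prod_pow_eq_pow_sum, h1, map_mul, map_prod,
    map_pow, Polynomial.algebraMap_eq]
  ring

theorem eval_eq_sum_coeff_of_isHomogeneous {g : MvPolynomial (Fin n) k} (hg : g.IsHomogeneous 1)
    (p : Fin n → k) : eval p g = ∑ m, coeff (Finsupp.single m 1) g * p m := by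
  have hg' : g ∈ Submodule.span k (Set.range X) := by
    rwa [← homogeneousSubmodule_one_eq_span_X]
  clear hg
  induction hg' using Submodule.span_induction with
  | mem x hx =>
    obtain ⟨i, rfl⟩ := hx
    simp [coeff_X, Finsupp.single_left_inj]
  | zero => simp
  | add x y _ _ hx hy => simp [hx, hy, add_mul, Finset.sum_add_distrib]
  | smul c x _ hx => simp [hx, smul_eval, Finset.mul_sum, mul_assoc]

/-- If a homogeneous regular sequence generates an ideal which contains powers of the variables and
is generated by linear forms, then its members are linear forms. -/
theorem degree_eq_one_of_isGeneratedByLinearForms {f : Fin n → MvPolynomial (Fin n) k}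
    {d : Fin n → ℕ} (hf : ∀ i, (f i).IsHomogeneous (d i)) (hd : ∀ i, 0 < d i)
    (hpow : ∀ m, ∃ N, (X m : MvPolynomial (Fin n) k) ^ N ∈ Ideal.span (Set.range f))
    (hlin : IsGeneratedByLinearForms (Ideal.span (Set.range f))) (j : Fin n) : d j = 1 := by
  by_contra hj
  obtain ⟨T, hT, hTI⟩ := hlin
  -- If `d j ≠ 1`, the linear parts of the other `n - 1` generators have a common zero `p ≠ 0`.
  let L : (Fin n → k) →ₗ[k] ({ i : Fin n // i ≠ j } → k) :=
    LinearMap.pi fun i => ∑ m, coeff (Finsupp.single m 1) (f i) • LinearMap.proj m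
  have hL : ∀ p i, L p i = ∑ m, coeff (Finsupp.single m 1) (f i) * p m := fun p i => by
    simp [L, LinearMap.sum_apply]
  have hker : LinearMap.ker L ≠ ⊥ := by
    refine LinearMap.ker_ne_bot_of_finrank_lt ?_
    have : 0 < n := Fin.pos j
    rw [Module.finrank_fintype_fun_eq_card, Module.finrank_fintype_fun_eq_card,
      Fintype.card_subtype_compl, Fintype.card_subtype_eq, Fintype.card_fin]
    omega
  obtain ⟨p, hp, hp0⟩ := Submodule.exists_mem_ne_zero_of_ne_bot hker
  let ρ : MvPolynomial (Fin n) k →ₐ[k] Polynomial k :=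
    aeval fun i => Polynomial.C (p i) * Polynomial.X
  -- On the line through `p`, generators of degree `1` vanish and the others restrict to multiples
  -- of `X ^ 2`.
  have hI : Ideal.span (Set.range f) ≤ (Ideal.span {Polynomial.X ^ 2}).comap ρ := by
    rw [Ideal.span_le]
    rintro _ ⟨i, rfl⟩
    rw [SetLike.mem_coe, Ideal.mem_comap, Ideal.mem_span_singleton]
    change _ ∣ aeval _ (f i)
    rw [aeval_C_mul_X_of_isHomogeneous (hf i)]
    by_cases hi : d i = 1
    · have hij : i ≠ j := fun h => hj (h ▸ hi)
      have h1 := congrFun (LinearMap.mem_ker.1 hp) ⟨i, hij⟩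
      rw [hL] at h1
      have h2 := eval_eq_sum_coeff_of_isHomogeneous (hi ▸ hf i) p
      rw [h2, h1]
      simp
    · exact Dvd.dvd.mul_left (pow_dvd_pow _ (by have := hd i; omega)) _
  -- A linear form in the ideal restricts to a multiple of `X` divisible by `X ^ 2`, so it vanishes
  -- at `p`. Linear forms generate, hence the whole ideal vanishes at `p`, and the powers of the
  -- variables in it force `p = 0`.
  have hI' : Ideal.span (Set.range f) ≤ RingHom.ker (eval p) := by
    rw [← hTI, Ideal.span_le]
    intro t ht
    have h1 : t ∈ Ideal.span (Set.range f) := hTI ▸ Ideal.subset_span ht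
    have h2 := Ideal.mem_span_singleton.1 (Ideal.mem_comap.1 (hI h1))
    change _ ∣ aeval _ t at h2
    rw [aeval_C_mul_X_of_isHomogeneous (hT t ht), Polynomial.X_pow_dvd_iff] at h2
    simpa using h2 1 (by omega)
  refine hp0 ?_
  ext m
  obtain ⟨N, hN⟩ := hpow m
  have h1 := hI' hN
  rw [RingHom.mem_ker, map_pow, eval_X] at h1
  exact eq_zero_of_pow_eq_zero h1

end MvPolynomial

/-! ### Bounds on sums of degrees. -/

section DegreeBounds

/-- The terms `d i - 1` are nonnegative, so the three at the distinct indices `0`, `1`, `n - 1` sum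
to at most the total. -/
theorem add_le_sum_of_three_le {n : ℕ} {d : Fin n → ℕ} (hn : 3 ≤ n) (hpos : ∀ i, 0 < d i) :
    (d ⟨0, by omega⟩ : ℤ) + d ⟨1, by omega⟩ + d ⟨n - 1, by omega⟩ + n ≤ ∑ i, (d i : ℤ) + 3 := by
  let T : Finset (Fin n) := {⟨0, by omega⟩, ⟨1, by omega⟩, ⟨n - 1, by omega⟩}
  have h1 : ∑ i ∈ T, ((d i : ℤ) - 1) ≤ ∑ i, ((d i : ℤ) - 1) :=
    Finset.sum_le_sum_of_subset_of_nonneg (Finset.subset_univ _) fun i _ _ => by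
      have := hpos i
      omega
  rw [Finset.sum_insert (by simp [Fin.ext_iff]; omega),
    Finset.sum_pair (by simp [Fin.ext_iff]; omega), Finset.sum_sub_distrib] at h1
  simp at h1
  omega

variable {n : ℕ} (hn : 2 ≤ n) {d : Fin n → ℕ} (hd : Monotone d)
include hd

theorem add_le_sum_of_two_le_card {T : Finset (Fin n)} (hT : 2 ≤ T.card) :
    (d ⟨0, by omega⟩ : ℤ) + d ⟨1, by omega⟩ ≤ ∑ t ∈ T, (d t : ℤ) := by
  obtain ⟨s, hs, t, ht, hst⟩ := Finset.one_lt_card.1 hT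
  wlog h : s < t generalizing s t
  · exact this t ht s hs hst.symm (lt_of_le_of_ne (not_lt.1 h) hst.symm)
  have h0 : d ⟨0, by omega⟩ ≤ d s := hd (Fin.mk_le_of_le_val (Nat.zero_le _))
  have h1 : d ⟨1, by omega⟩ ≤ d t := hd (Fin.mk_le_of_le_val (by
    have := Fin.lt_def.1 h
    omega))
  have h2 : ∑ i ∈ {s, t}, (d i : ℤ) ≤ ∑ i ∈ T, (d i : ℤ) :=
    Finset.sum_le_sum_of_subset_of_nonneg (by
      intro i hi
      rcases Finset.mem_insert.1 hi with rfl | hi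
      · exact hs
      · rwa [Finset.mem_singleton.1 hi]) fun _ _ _ => Int.natCast_nonneg _
  rw [Finset.sum_pair hst] at h2
  omega

/-- The largest index contributes at most the top degree, and each of the remaining `q + 1` indices
is smaller, so contributes at most the second largest. Then one copy of the top degree is at most `q
+ 1` copies. -/
theorem sum_le_mul_add {T : Finset (Fin n)} {q : ℕ} (hT : T.card = q + 2) :
    ∑ t ∈ T, (d t : ℤ) ≤ (q + 1 : ℕ) * ((d ⟨n - 2, by omega⟩ : ℤ) + d ⟨n - 1, by omega⟩) := by
  have hne : T.Nonempty := Finset.card_pos.1 (by omega)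
  have hm := T.max'_mem hne
  rw [← Finset.add_sum_erase T _ hm]
  have h1 : d (T.max' hne) ≤ d ⟨n - 1, by omega⟩ := hd (Fin.le_def.2 (by
    have := (T.max' hne).2
    simp only
    omega))
  have h2 : ∑ t ∈ T.erase (T.max' hne), (d t : ℤ) ≤
      (T.erase (T.max' hne)).card • (d ⟨n - 2, by omega⟩ : ℤ) := by
    refine Finset.sum_le_card_nsmul _ _ _ fun t ht => ?_
    have h3 : t < T.max' hne := lt_of_le_of_ne (T.le_max' t (Finset.mem_of_mem_erase ht))
      (Finset.ne_of_mem_erase ht)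
    have h4 : t ≤ ⟨n - 2, by omega⟩ := Fin.le_def.2 (by
      have := Fin.lt_def.1 h3
      have := (T.max' hne).2
      simp only
      omega)
    exact_mod_cast hd h4
  rw [Finset.card_erase_of_mem hm, hT, show q + 2 - 1 = q + 1 by omega, nsmul_eq_mul] at h2
  have h5 : (0 : ℤ) ≤ d ⟨n - 1, by omega⟩ := Int.natCast_nonneg _
  have h6 : (d (T.max' hne) : ℤ) ≤ d ⟨n - 1, by omega⟩ := by exact_mod_cast h1
  push_cast at h2 ⊢
  nlinarith

end DegreeBounds

/-! ### Rigidity criterion for complete intersections. -/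

section CompleteIntersection

open MvPolynomial

attribute [local instance] MvPolynomial.gradedAlgebra

variable {k : Type u} [Field k] {n : ℕ} {f : Fin n → MvPolynomial (Fin n) k} {d : Fin n → ℕ}

theorem ofList_take_ofFn {S : Type u} [CommRing S] {n : ℕ} (f : Fin n → S) (i : ℕ) :
    Ideal.ofList ((List.ofFn f).take i) = initialIdeal f i := by
  rw [Ideal.ofList, initialIdeal]
  congr 1
  ext r
  simp only [Set.mem_ofPred_eq, Set.mem_image, List.mem_take_iff_getElem, List.length_ofFn,
    List.getElem_ofFn]
  constructor
  · rintro ⟨t, ht, rfl⟩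
    exact ⟨⟨t, by omega⟩, by simp only; omega, rfl⟩
  · rintro ⟨t, ht, rfl⟩
    exact ⟨t, by omega, rfl⟩

theorem mem_initialIdeal_of_isRegular {S : Type u} [CommRing S] {n : ℕ} {f : Fin n → S}
    (hreg : RingTheory.Sequence.IsRegular S (List.ofFn f)) (i : Fin n) (x : S)
    (hx : f i * x ∈ initialIdeal f i) : x ∈ initialIdeal f i := by
  have h := hreg.regular_mod_prev i (by simp)
  rw [ofList_take_ofFn, smul_eq_mul, Ideal.mul_top, List.getElem_ofFn,
    isSMulRegular_quotient_iff_mem_of_smul_mem] at h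
  exact h x hx

theorem span_ne_top_of_isRegular {S : Type u} [CommRing S] {n : ℕ} {f : Fin n → S}
    (hreg : RingTheory.Sequence.IsRegular S (List.ofFn f)) : Ideal.span (Set.range f) ≠ ⊤ := by
  have h := hreg.top_ne_smul
  rw [smul_eq_mul, Ideal.mul_top] at h
  have h2 := ofList_take_ofFn f n
  rw [List.take_of_length_le (by simp), initialIdeal_self] at h2
  rw [← h2]
  exact h.symm

/-- A generator of degree `0` is a constant. A nonzero constant generates the unit ideal, and zero
can be regular modulo its predecessors only if they already do; a regular sequence excludes both. -/
theorem degree_pos_of_isRegular (hf : ∀ i, (f i).IsHomogeneous (d i))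
    (hreg : RingTheory.Sequence.IsRegular (MvPolynomial (Fin n) k) (List.ofFn f)) (i : Fin n) :
    0 < d i := by
  rw [Nat.pos_iff_ne_zero]
  intro hi
  have h1 := hf i
  rw [hi, ← totalDegree_zero_iff_isHomogeneous, totalDegree_eq_zero_iff_eq_C] at h1
  refine span_ne_top_of_isRegular hreg ((Ideal.eq_top_iff_one _).2 ?_)
  by_cases hc : coeff 0 (f i) = 0
  · rw [hc, map_zero] at h1
    have h2 := mem_initialIdeal_of_isRegular hreg i 1 (by rw [h1, zero_mul]; exact zero_mem _)
    exact Ideal.span_mono (Set.image_subset_range _ _) h2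
  · have h2 : f i ∈ Ideal.span (Set.range f) := Ideal.subset_span ⟨i, rfl⟩
    have h3 := Ideal.mul_mem_left _ (C (coeff 0 (f i))⁻¹) h2
    rw [h1, coeff_C, if_pos rfl, ← map_mul, inv_mul_cancel₀ hc, map_one] at h3
    exact h3

/-- Rigidity of a complete intersection follows from the vanishing of its graded components in the
degrees given by the sums of at least two of the degrees of the generators. -/
theorem isRigidModule_of_quotientGrading_eq_bot (hf : ∀ i, (f i).IsHomogeneous (d i))
    (hreg : RingTheory.Sequence.IsRegular (MvPolynomial (Fin n) k) (List.ofFn f)) {a : ℤ}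
    (h : ∀ (p : ℕ) (T : Finset (Fin n)), T.card = p + 2 →
      quotientGrading (homogeneousSubmodule (Fin n) k) (Ideal.span (Set.range f))
        (∑ t ∈ T, (d t : ℤ) + -((p + 1 : ℕ) * a)) = ⊥) :
    IsRigidModule (homogeneousSubmodule (Fin n) k)
      (MvPolynomial (Fin n) k ⧸ Ideal.span (Set.range f))
      (quotientGrading (homogeneousSubmodule (Fin n) k) (Ideal.span (Set.range f))) a := by
  have hhom := initialIdeal_isHomogeneous (𝒜 := homogeneousSubmodule (Fin n) k) hf n
  obtain ⟨K, hK, hKb⟩ := GradedFreeComplex.exists_resolution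
    (𝒜 := homogeneousSubmodule (Fin n) k) hf (mem_initialIdeal_of_isRegular hreg) n le_rfl
  rw [initialIdeal_self] at hK hhom
  have hP := quotientGrading_isModuleGrading hhom
  refine ⟨⟨K, hK⟩, fun C hC => C.isRigid_of_extVanishes hP hC
    (GradedFreeComplex.IsResolutionOf.extVanishes hP hC hK fun p => ?_)⟩
  obtain ⟨r, b, hb⟩ := hKb (p + 2)
  refine ⟨r, b, fun t => ?_⟩
  obtain ⟨_, ⟨T, -, hT, rfl⟩, hbt⟩ := hb t
  exact ⟨_, hbt, h p T hT⟩

theorem quotientGrading_eq_bot_of_sum_lt (hn : 0 < n) (hf : ∀ i, (f i).IsHomogeneous (d i))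
    (hreg : RingTheory.Sequence.IsRegular (MvPolynomial (Fin n) k) (List.ofFn f)) {m : ℤ}
    (hm : m < 0 ∨ ∑ i, (d i : ℤ) - n < m) :
    quotientGrading (homogeneousSubmodule (Fin n) k) (Ideal.span (Set.range f)) m = ⊥ := by
  by_cases h0 : m < 0
  · exact quotientGrading_of_neg h0
  replace hm := hm.resolve_left h0
  lift m to ℕ using not_lt.1 h0
  rw [eq_bot_iff]
  intro x hx
  obtain ⟨s, hs, rfl⟩ := mem_quotientGrading_natCast.1 hx
  refine Ideal.Quotient.eq_zero_iff_mem.2 (mem_span_of_sum_lt hn hf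
    (degree_pos_of_isRegular hf hreg) (mem_initialIdeal_of_isRegular hreg) ?_ hs)
  zify
  linarith

end CompleteIntersection

theorem mainTheorem5 {k : Type u} [Field k] (n : ℕ) (hn : 2 ≤ n)
    (f : Fin n → MvPolynomial (Fin n) k) (d : Fin n → ℕ)
    (hf : ∀ i, (f i).IsHomogeneous (d i)) (hd : Monotone d)
    (hreg : RingTheory.Sequence.IsRegular (MvPolynomial (Fin n) k) (List.ofFn f))
    (I : Ideal (MvPolynomial (Fin n) k)) (hI : I = Ideal.span (Set.range f))
    (hart : IsArtinianRing (MvPolynomial (Fin n) k ⧸ I)) :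
    (¬ IsGeneratedByLinearForms I → ∀ a : ℤ,
      (a < (d ⟨0, by omega⟩ : ℤ) + d ⟨1, by omega⟩ + n - ∑ i, (d i : ℤ) ∨
        (d ⟨n - 2, by omega⟩ : ℤ) + d ⟨n - 1, by omega⟩ < a) →
      IsRigidModule (MvPolynomial.homogeneousSubmodule (Fin n) k)
        (MvPolynomial (Fin n) k ⧸ I)
        (quotientGrading (MvPolynomial.homogeneousSubmodule (Fin n) k) I) a) ∧
    (IsGeneratedByLinearForms I → ∀ a : ℤ, a ≠ 2 →
      IsRigidModule (MvPolynomial.homogeneousSubmodule (Fin n) k)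
        (MvPolynomial (Fin n) k ⧸ I)
        (quotientGrading (MvPolynomial.homogeneousSubmodule (Fin n) k) I) a) := by
  subst hI
  have hpos := degree_pos_of_isRegular hf hreg
  refine ⟨fun hlin a ha => ?_, fun hlin a ha => ?_⟩
  · refine isRigidModule_of_quotientGrading_eq_bot hf hreg fun p T hT =>
      quotientGrading_eq_bot_of_sum_lt (by omega) hf hreg ?_
    have hlow := add_le_sum_of_two_le_card hn hd (T := T) (by omega)
    rcases ha with ha | ha
    · right
      -- With `(p + 1) * a ≤ a`, the bound on `a` and the lower bound on `∑_T d` put the degree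
      -- above `∑ d i - n`.
      suffices h : (p + 1 : ℕ) * a ≤ a by linarith
      rcases le_or_gt a 0 with h0 | h0
      · push_cast
        nlinarith
      · rcases Nat.eq_zero_or_pos p with rfl | hp
        · simp
        · exfalso
          have hTn : T.card ≤ n := by simpa using T.card_le_univ
          have h3 := add_le_sum_of_three_le (by omega) hpos
          refine hlin ⟨Set.range f, ?_, rfl⟩
          rintro _ ⟨i, rfl⟩
          have h4 : d i ≤ d ⟨n - 1, by omega⟩ := hd (Fin.le_def.2 (by
            have := i.2
            simp only
            omega))
          have h5 : d i = 1 := by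
            have := hpos i
            omega
          exact h5 ▸ hf i
    · left
      have hup := sum_le_mul_add hn hd hT
      have h1 : ((p + 1 : ℕ) : ℤ) * ((d ⟨n - 2, by omega⟩ : ℤ) + d ⟨n - 1, by omega⟩) <
          (p + 1 : ℕ) * a := mul_lt_mul_of_pos_left ha (by positivity)
      linarith
  -- The exponent `∑ d i + 1` is beyond the top degree of the quotient, so these powers of the
  -- variables lie in the ideal.
  · have hone : ∀ i, d i = 1 := MvPolynomial.degree_eq_one_of_isGeneratedByLinearForms hf hpos
      (fun m => ⟨∑ i, d i + 1, MvPolynomial.mem_span_of_sum_lt (by omega) hf hpos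
        (mem_initialIdeal_of_isRegular hreg) (by omega) (MvPolynomial.isHomogeneous_X_pow _ _)⟩) hlin
    refine isRigidModule_of_quotientGrading_eq_bot hf hreg fun p T hT =>
      quotientGrading_eq_bot_of_sum_lt (by omega) hf hreg ?_
    simp only [hone, Finset.sum_const, hT, Finset.card_univ, Fintype.card_fin]
    -- Only degree `0` of the quotient survives; equality would read `(p + 1) * (a - 1) = 1`,
    -- forcing `p = 0` and `a = 2`.
    have h1 : (p + 2 : ℤ) + -((p + 1 : ℕ) * a) ≠ 0 := by
      intro h
      have h2 : (p + 1 : ℤ) * (a - 1) = 1 := by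
        push_cast at h
        linarith
      have h3 : (p + 1 : ℤ) = 1 := Int.eq_one_of_mul_eq_one_right (by positivity) h2
      rw [h3] at h2
      omega
    simp only [nsmul_eq_mul]
    push_cast at h1 ⊢
    omega
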